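/- Let $G=(V,E)$ be a hidden connected, unweighted, undirected simple graph on a known finite vertex set $V$ with $|V|=n$, let $\Delta$ be its maximum degree and $\mathrm{tw}$ its treewidth. A shortest path oracle receives a pair $(u,v)\in V^2$ and returns a shortest path of $G$ between $u$ and $v$. The goal of graph reconstruction is to find $E$; the query complexity of an algorithm is the number of queries that it makes to the oracle. For a graph $X$ on $V$ with distance function $\delta_X$ and $(u,v)\in V^2$, let $S^X_{u,v}$ be the set of the non-edges $\{a,b\}$ of $X$ (pairs of distinct non-adjacent vertices) with $\delta_X(u,a)+\delta_X(b,v)+1<\delta_X(u,v)$ (for one of the two orders of $a$ and $b$). Consider the following greedy algorithm, which is given only $V$ and the oracle. Fix an arbitrary $u_0\in V$, query $(u,u_0)$ for every $u\in V\setminus\{u_0\}$, let $X$ be the union of the paths returned, and let $Y=\emptyset$. While $X\cup Y$ does not contain all pairs of distinct vertices, choose $(u,v)$ that maximizes $|S^X_{u,v}\setminus Y|$ and query it; if the path returned has length $\delta_X(u,v)$, replace $Y$ by $Y\cup S^X_{u,v}$; otherwise add to $X$ some edge of that path that does not belong to $X$. Finally return $X$. Theorem. With any deterministic rule for the choices left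 open (such rules exist whenever $V\neq\emptyset$), this is a deterministic algorithm that, for every connected $G$ and every shortest path oracle of $G$, terminates and returns exactly $G$, with the following bounds on its number of queries, in which the implied constants are absolute. 1. For $n\ge 3$, it makes at most $n^{1+O\left(\sqrt{(\log\log n+\log\Delta)/\log n}\right)}$ queries. This is $n^{1+o(1)}$ when $\Delta=n^{o(1)}$. 2. It makes $O\left(\Delta(\Delta+\mathrm{tw}\log n)\,n\log^2 n\right)$ queries. This is $\tilde O(n)$, i.e. $n$ times a power of $\log n$ up to a constant factor, when $\Delta$ and $\mathrm{tw}$ are $O(\mathrm{polylog}\,n)$. -/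

import Mathlib

universe u

namespace SPReconstruction

/-- A shortest path oracle for `G`: to every ordered pair `(u, v)` it assigns a shortest
walk of `G` from `u` to `v`. -/
structure ShortestPathOracle {V : Type u} (G : SimpleGraph V) where
  path : ∀ u v : V, G.Walk u v
  length_path : ∀ u v : V, (path u v).length = G.dist u v

/-- What a reconstruction algorithm does next: query a pair, or stop and return a graph. -/
inductive Action (V : Type u) : Type u
  | query (u v : V) : Action V
  | output (X : SimpleGraph V) : Action V

/-- A deterministic adaptive reconstruction algorithm on the vertex set `V`. Its only access to
the hidden graph is through the answers to its queries; the answer to a query `(u, v)` is a path,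
given as the list of its edges in the order from `u` to `v`. -/
structure QueryAlgorithm (V : Type u) where
  State : Type u
  init : State
  action : State → Action V
  next : State → List (Sym2 V) → State

/-- `A.Run O s q X`: started in state `s` with the oracle `O`, the algorithm `A` makes exactly
`q` queries, then stops and returns `X`. -/
inductive QueryAlgorithm.Run {V : Type u} (A : QueryAlgorithm V) {G : SimpleGraph V}
    (O : ShortestPathOracle G) : A.State → ℕ → SimpleGraph V → Prop
  | halt {s : A.State} {X : SimpleGraph V} (h : A.action s = Action.output X) : Run A O s 0 X
  | ask {s : A.State} {u v : V} {q : ℕ} {X : SimpleGraph V} (h : A.action s = Action.query u v)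
      (hrun : Run A O (A.next s (O.path u v).edges) q X) : Run A O s (q + 1) X

/-- With every shortest path oracle of `G`, the algorithm `A` terminates, returns exactly `G`,
and makes at most `b` queries. -/
def QueryAlgorithm.ReconstructsWithin {V : Type u} (A : QueryAlgorithm V) (G : SimpleGraph V)
    (b : ℝ) : Prop :=
  ∀ O : ShortestPathOracle G, ∃ q : ℕ, A.Run O A.init q G ∧ (q : ℝ) ≤ b

/-- The set `S^X_{u,v}` of the non-edges `{a, b}` of `X` with
`δ_X(u,a) + δ_X(b,v) + 1 < δ_X(u,v)` (for one of the two orders of `a` and `b`). -/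
def confirmed {V : Type u} (X : SimpleGraph V) (u v : V) : Set (Sym2 V) :=
  {e | ∃ a b : V, e = s(a, b) ∧ a ≠ b ∧ ¬ X.Adj a b ∧ X.dist u a + X.dist b v + 1 < X.dist u v}

/-- The choices that the greedy algorithm leaves open: the vertex `u₀` (`root`), the order in
which the other vertices are treated in the initial loop, the pair `(u, v)` among those that
maximize `|S^X_{u,v} \ Y|`, and the new edge on the path that was returned. -/
structure GreedyRule (V : Type u) where
  root : V
  order : List V
  nodup_order : order.Nodup
  mem_order : ∀ u : V, u ∈ order ↔ u ≠ root
  pick : SimpleGraph V → Set (Sym2 V) → V × V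
  pick_max : ∀ (X : SimpleGraph V) (Y : Set (Sym2 V)) (u v : V),
    (confirmed X u v \ Y).ncard ≤ (confirmed X (pick X Y).1 (pick X Y).2 \ Y).ncard
  pickEdge : SimpleGraph V → Set (Sym2 V) → List (Sym2 V) → Sym2 V
  pickEdge_spec : ∀ (X : SimpleGraph V) (Y : Set (Sym2 V)) (p : List (Sym2 V)),
    (∃ e ∈ p, e ∉ X.edgeSet) → pickEdge X Y p ∈ p ∧ pickEdge X Y p ∉ X.edgeSet

/-- State of the greedy algorithm: the vertices that remain to be treated in the initial loop,
the candidate graph `X`, and the set `Y` of confirmed non-edges. -/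
structure GreedyState (V : Type u) where
  pending : List V
  X : SimpleGraph V
  Y : Set (Sym2 V)

open Classical in
/-- Greedy reconstruction. First `(w, u₀)` is queried for every `w ≠ u₀`, and `X` becomes the
union of the paths returned, while `Y = ∅`. Then, as long as `X ∪ Y` does not contain all pairs
of distinct vertices, a pair `(u, v)` that maximizes `|S^X_{u,v} \ Y|` is queried; if the path
returned has length `δ_X(u,v)`, then `S^X_{u,v}` is added to `Y`, and otherwise an edge of the
path that is not in `X` is added to `X`. Finally `X` is returned. -/
noncomputable def greedy {V : Type u} (r : GreedyRule V) : QueryAlgorithm V where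
  State := GreedyState V
  init := ⟨r.order, ⊥, ∅⟩
  action := fun s =>
    match s.pending with
    | w :: _ => Action.query w r.root
    | [] =>
      if ∀ a b : V, a ≠ b → s.X.Adj a b ∨ s(a, b) ∈ s.Y then Action.output s.X
      else Action.query (r.pick s.X s.Y).1 (r.pick s.X s.Y).2
  next := fun s p =>
    match s.pending with
    | _ :: rest => ⟨rest, s.X ⊔ SimpleGraph.fromEdgeSet {e | e ∈ p}, s.Y⟩
    | [] =>
      if p.length = s.X.dist (r.pick s.X s.Y).1 (r.pick s.X s.Y).2 then
        ⟨[], s.X, s.Y ∪ confirmed s.X (r.pick s.X s.Y).1 (r.pick s.X s.Y).2⟩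
      else
        ⟨[], s.X ⊔ SimpleGraph.fromEdgeSet {r.pickEdge s.X s.Y p}, s.Y⟩

/-- A tree decomposition of `G`, with tree nodes `0, …, size - 1`. -/
structure TreeDecomposition {V : Type u} (G : SimpleGraph V) where
  size : ℕ
  tree : SimpleGraph (Fin size)
  isTree : tree.IsTree
  bag : Fin size → Finset V
  connected_nodes : ∀ v : V, (tree.induce {i | v ∈ bag i}).Connected
  edge_in_bag : ∀ u v : V, G.Adj u v → ∃ i, u ∈ bag i ∧ v ∈ bag i

/-- The size of the largest bag minus one (there is a nonempty bag when `V` is nonempty). -/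
def TreeDecomposition.width {V : Type u} {G : SimpleGraph V} (D : TreeDecomposition G) : ℕ :=
  (Finset.univ.sup fun i => (D.bag i).card) - 1

/-- The minimum width of a tree decomposition of `G` (one exists when `V` is finite). -/
noncomputable def treewidth {V : Type u} (G : SimpleGraph V) : ℕ :=
  sInf {k | ∃ D : TreeDecomposition G, D.width = k}

end SPReconstruction

/-! A query made after the initial loop either reveals a new edge, which happens at most $n\Delta$
times, or confirms the non-edges in $S^X_{u,v}$. Confirmation is sound because $X\le G$ gives
$\delta_G\le\delta_X$: an edge of $G$ in $S^X_{u,v}$ would shorten the shortest path just returned.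
If some $N$ queries together confirm all non-edges of $X$, the greedy choice confirms at least a
fraction $1/N$ of the unresolved pairs. So $O(N\log n)$ confirming queries suffice
(`run_of_pending_nil`, `reconstructsWithin_of_cover`). It remains to find small covers for every
connected spanning subgraph $X$ of $G$; such an $X$ inherits the bounds on degree and treewidth.

General bound: $O(s\log n)$ centers suffice for each vertex $w$ to have at most $|U|/s$ vertices of
$U$ closer to it than to all centers (`exists_centers`). Queries from the vertices within distance
two of the centers confirm every pair not contained in the cluster of one such vertex
(`isCover_step`), and the clusters are treated recursively. Taking $s=n^{1/k}$ with
$k\approx\sqrt{\log n/(\log\log n+\log\Delta)}$ balances the costs.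

Treewidth bound: some bag $S$ is a balanced separator
(`TreeDecomposition.exists_balanced_separator`). Queries from its closed neighborhood confirm every
non-edge that meets $S$ or is separated by $S$ (`isCover_separator_step`), and recursion on the
components has at most $\log_2 n$ levels. -/

namespace SPReconstruction

/-! ### Greedy covering and the number of queries -/

/-- An upper bound for the number of steps in which a natural number `x` can be brought to zero
when every step multiplies it by at most `1 - 1 / N`. -/
noncomputable def decayBound (N : ℝ) (x : ℕ) : ℝ :=
  if x = 0 then 0 else 1 + N * Real.log x

theorem decayBound_zero (N : ℝ) : decayBound N 0 = 0 := by simp [decayBound]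

theorem decayBound_of_pos (N : ℝ) {x : ℕ} (hx : 0 < x) :
    decayBound N x = 1 + N * Real.log x := by
  simp [decayBound, hx.ne']

theorem decayBound_nonneg {N : ℝ} (hN : 0 ≤ N) (x : ℕ) : 0 ≤ decayBound N x := by
  unfold decayBound
  split_ifs
  · exact le_rfl
  · have := Real.log_natCast_nonneg x
    positivity

theorem decayBound_mono {N : ℝ} (hN : 0 ≤ N) {x y : ℕ} (h : x ≤ y) :
    decayBound N x ≤ decayBound N y := by
  rcases Nat.eq_zero_or_pos x with rfl | hx
  · rw [decayBound_zero]; exact decayBound_nonneg hN y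
  · rw [decayBound_of_pos N hx, decayBound_of_pos N (hx.trans_le h)]
    have : Real.log x ≤ Real.log y :=
      Real.log_le_log (by exact_mod_cast hx) (by exact_mod_cast h)
    gcongr

/-- Since $\log t\le t-1$, the step lowers $\log x$ by at least $1/N$. The summand 1 in `decayBound`
pays for the step that reaches zero. -/
theorem decayBound_step {N : ℝ} (hN : 0 < N) {x y : ℕ} (hx : 0 < x)
    (h : (y : ℝ) ≤ x - x / N) : decayBound N y + 1 ≤ decayBound N x := by
  rw [decayBound_of_pos N hx]
  have hx1 : (1 : ℝ) ≤ x := by exact_mod_cast hx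
  rcases Nat.eq_zero_or_pos y with rfl | hy
  · rw [decayBound_zero]
    have := Real.log_nonneg hx1
    have : 0 ≤ N * Real.log x := by positivity
    linarith
  · rw [decayBound_of_pos N hy]
    have hy1 : (0 : ℝ) < y := by exact_mod_cast hy
    have hx0 : (0 : ℝ) < x := by linarith
    have h1 : Real.log (y / x) ≤ y / x - 1 := Real.log_le_sub_one_of_pos (by positivity)
    rw [Real.log_div hy1.ne' hx0.ne'] at h1
    have h2 : (y : ℝ) / x ≤ 1 - 1 / N := by
      rw [div_le_iff₀ hx0]
      calc (y : ℝ) ≤ x - x / N := h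
        _ = (1 - 1 / N) * x := by ring
    have h3 : N * Real.log y ≤ N * (Real.log x - 1 / N) := by
      apply mul_le_mul_of_nonneg_left _ hN.le
      linarith
    have h4 : N * (1 / N) = 1 := by field_simp
    nlinarith

/-- A set of queries whose confirmed sets contain all non-edges of `X` inside `U`. -/
def IsCover {V : Type u} (X : SimpleGraph V) (U : Finset V) (T : Finset (V × V)) : Prop :=
  ∀ a ∈ U, ∀ b ∈ U, a ≠ b → ¬ X.Adj a b → ∃ p ∈ T, s(a, b) ∈ confirmed X p.1 p.2

theorem confirmed_subset {V : Type u} (X : SimpleGraph V) (u v : V) :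
    confirmed X u v ⊆ {e | ¬ e.IsDiag ∧ e ∉ X.edgeSet} := by
  rintro e ⟨a, b, rfl, hab, hX, -⟩
  exact ⟨by simpa using hab, by simpa using hX⟩

theorem mem_confirmed_right {V : Type u} {X : SimpleGraph V} {u a b : V} (hab : a ≠ b)
    (hX : ¬ X.Adj a b) (h : X.dist u a + 1 < X.dist u b) : s(a, b) ∈ confirmed X u b :=
  ⟨a, b, rfl, hab, hX, by simpa using h⟩

theorem mem_confirmed_self {V : Type u} {X : SimpleGraph V} (hc : X.Connected) {a b : V}
    (hab : a ≠ b) (hX : ¬ X.Adj a b) : s(a, b) ∈ confirmed X a b := by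
  apply mem_confirmed_right hab hX
  rw [SimpleGraph.dist_self]
  have h0 : X.dist a b ≠ 0 := fun h => hab (hc.dist_eq_zero_iff.1 h)
  have h1 : X.dist a b ≠ 1 := fun h => hX (SimpleGraph.dist_eq_one_iff_adj.1 h)
  omega

/-- The pairs that are neither edges of `X` nor in `Y`. -/
def unresolved {V : Type u} (X : SimpleGraph V) (Y : Set (Sym2 V)) : Set (Sym2 V) :=
  {e | ¬ e.IsDiag ∧ e ∉ X.edgeSet ∧ e ∉ Y}

theorem confirmed_diff_subset {V : Type u} (X : SimpleGraph V) (Y : Set (Sym2 V)) (u v : V) :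
    confirmed X u v \ Y ⊆ unresolved X Y := fun _ he =>
  ⟨(confirmed_subset X u v he.1).1, (confirmed_subset X u v he.1).2, he.2⟩

/-- Pigeonhole: for the greedy maximum $m$, the chosen query confirms at least a $1/|T|$ share of
what is unresolved. -/
theorem ncard_unresolved_le {V : Type u} [Fintype V] {X : SimpleGraph V} {Y : Set (Sym2 V)}
    {T : Finset (V × V)} (hT : IsCover X Finset.univ T) {m : ℕ}
    (hm : ∀ u v, (confirmed X u v \ Y).ncard ≤ m) :
    (unresolved X Y).ncard ≤ T.card * m := by
  have hsub : unresolved X Y ⊆ ⋃ p ∈ T, (confirmed X p.1 p.2 \ Y) := by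
    intro e he
    induction e using Sym2.ind with
    | _ a b =>
      obtain ⟨h1, h2, h3⟩ := he
      obtain ⟨p, hp, hpe⟩ := hT a (Finset.mem_univ _) b (Finset.mem_univ _)
        (by simpa using h1) (by simpa using h2)
      exact Set.mem_biUnion hp ⟨hpe, h3⟩
  calc (unresolved X Y).ncard ≤ (⋃ p ∈ T, (confirmed X p.1 p.2 \ Y)).ncard :=
        Set.ncard_le_ncard hsub (Set.toFinite _)
    _ ≤ ∑ p ∈ T, (confirmed X p.1 p.2 \ Y).ncard := Finset.set_ncard_biUnion_le _ _
    _ ≤ ∑ _p ∈ T, m := Finset.sum_le_sum fun p _ => hm _ _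
    _ = T.card * m := by simp

/-- Soundness of $Y$: an edge of $G$ in the confirmed set would give a $u$–$v$ walk in $G$ shorter
than `X.dist u v = G.dist u v`. -/
theorem confirmed_disjoint_edgeSet {V : Type u} {G X : SimpleGraph V} (hX : X.Connected)
    (hXG : X ≤ G) {u v : V} (h : G.dist u v = X.dist u v) :
    Disjoint (confirmed X u v) G.edgeSet := by
  rw [Set.disjoint_left]
  rintro e ⟨a, b, rfl, -, -, hlt⟩ he
  have hG : G.Connected := hX.mono hXG
  have hab : G.Adj a b := he
  have h1 : G.dist u a ≤ X.dist u a := (hX u a).dist_anti hXG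
  have h2 : G.dist b v ≤ X.dist b v := (hX b v).dist_anti hXG
  have h3 : G.dist u v ≤ G.dist u a + G.dist a v := hG.dist_triangle
  have h4 : G.dist a v ≤ G.dist a b + G.dist b v := hG.dist_triangle
  have h5 : G.dist a b = 1 := SimpleGraph.dist_eq_one_iff_adj.2 hab
  omega

theorem exists_edge_notMem_of_dist_ne {V : Type u} {G X : SimpleGraph V}
    (hXG : X ≤ G) (hX : X.Connected) {u v : V} (p : G.Walk u v) (hp : p.length = G.dist u v)
    (h : p.length ≠ X.dist u v) : ∃ e ∈ p.edges, e ∉ X.edgeSet := by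
  by_contra! hcon
  have h1 : X.dist u v ≤ (p.transfer X hcon).length := SimpleGraph.dist_le _
  rw [SimpleGraph.Walk.length_transfer] at h1
  have h2 : G.dist u v ≤ X.dist u v := (hX u v).dist_anti hXG
  omega

/-- Each query pays for itself: a new edge lowers the first summand by one without raising the
second, and a confirmation lowers `decayBound` by at least one. The number of unresolved pairs drops
in both cases, hence the induction. -/
theorem run_of_pending_nil {V : Type u} [Fintype V] (r : GreedyRule V) {G : SimpleGraph V}
    (O : ShortestPathOracle G) {N : ℝ}
    (hN : ∀ X : SimpleGraph V, X.Connected → X ≤ G →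
      ∃ T : Finset (V × V), IsCover X Finset.univ T ∧ (T.card : ℝ) ≤ N) :
    ∀ (m : ℕ) (X : SimpleGraph V) (Y : Set (Sym2 V)), X.Connected → X ≤ G →
      Disjoint Y G.edgeSet → (unresolved X Y).ncard = m →
      ∃ q : ℕ, (greedy r).Run O (⟨[], X, Y⟩ : GreedyState V) q G ∧
        (q : ℝ) ≤ (G.edgeSet \ X.edgeSet).ncard + decayBound N m := by
  intro m
  induction m using Nat.strong_induction_on with
  | _ m ih =>
    intro X Y hX hXG hY hm
    by_cases hall : ∀ a b : V, a ≠ b → X.Adj a b ∨ s(a, b) ∈ Y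
    · have hGX : X = G := by
        refine le_antisymm hXG fun a b hab => ?_
        rcases hall a b hab.ne with h | h
        · exact h
        · exact absurd hab (Set.disjoint_left.1 hY h)
      subst hGX
      refine ⟨0, QueryAlgorithm.Run.halt ?_, ?_⟩
      · simp only [greedy]
        rw [if_pos hall]
      · have hm0 : m = 0 := by
          rw [← hm, Set.ncard_eq_zero (Set.toFinite _), Set.eq_empty_iff_forall_notMem]
          intro e he
          induction e using Sym2.ind with
          | _ a b =>
            obtain ⟨h1, h2, h3⟩ := he
            rcases hall a b (by simpa using h1) with h | h
            · exact h2 h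
            · exact h3 h
        simp [hm0, decayBound_zero]
    · have hpos : 0 < m := by
        push Not at hall
        obtain ⟨a, b, hab, h1, h2⟩ := hall
        rw [← hm, Set.ncard_pos (Set.toFinite _)]
        exact ⟨s(a, b), by simpa using hab, h1, h2⟩
      obtain ⟨T, hT, hTN⟩ := hN X hX hXG
      have hcov := ncard_unresolved_le hT (r.pick_max X Y)
      rw [hm] at hcov
      have hNpos : 0 < N := by
        refine lt_of_lt_of_le ?_ hTN
        have : T.card ≠ 0 := by
          intro h0
          rw [h0] at hcov
          omega
        exact_mod_cast Nat.pos_of_ne_zero this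
      have hact : (greedy r).action (⟨[], X, Y⟩ : GreedyState V) =
          Action.query (r.pick X Y).1 (r.pick X Y).2 := by
        simp only [greedy]
        rw [if_neg hall]
      set u := (r.pick X Y).1 with hu
      set v := (r.pick X Y).2 with hv
      by_cases hlen : (O.path u v).edges.length = X.dist u v
      · have hnext : (greedy r).next (⟨[], X, Y⟩ : GreedyState V) (O.path u v).edges =
            (⟨[], X, Y ∪ confirmed X u v⟩ : GreedyState V) := by
          simp only [greedy]
          rw [if_pos hlen]
        have hdist : G.dist u v = X.dist u v := by
          rw [← hlen, SimpleGraph.Walk.length_edges, O.length_path]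
        have hdisj := confirmed_disjoint_edgeSet hX hXG hdist
        have heq : unresolved X (Y ∪ confirmed X u v) =
            unresolved X Y \ (confirmed X u v \ Y) := by
          ext e
          simp only [unresolved, Set.mem_sdiff, Set.mem_union, Set.mem_ofPred_eq]
          tauto
        have hcard : (unresolved X (Y ∪ confirmed X u v)).ncard +
            (confirmed X u v \ Y).ncard = m := by
          rw [heq, ← hm]
          exact Set.ncard_sdiff_add_ncard_of_subset (confirmed_diff_subset X Y u v)
        have hc0 : 0 < (confirmed X u v \ Y).ncard := by
          rcases Nat.eq_zero_or_pos (confirmed X u v \ Y).ncard with h | h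
          · rw [h] at hcov; omega
          · exact h
        obtain ⟨q, hq, hqb⟩ := ih _ (by omega) X (Y ∪ confirmed X u v) hX hXG
          (Set.disjoint_union_left.2 ⟨hY, hdisj⟩) rfl
        refine ⟨q + 1, QueryAlgorithm.Run.ask hact (by rw [hnext]; exact hq), ?_⟩
        have hstep : decayBound N (unresolved X (Y ∪ confirmed X u v)).ncard + 1
            ≤ decayBound N m := by
          refine decayBound_step hNpos hpos ?_
          have h1 : (m : ℝ) / N ≤ (confirmed X u v \ Y).ncard := by
            rw [div_le_iff₀ hNpos]
            calc (m : ℝ) ≤ T.card * (confirmed X u v \ Y).ncard := by exact_mod_cast hcov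
              _ ≤ N * (confirmed X u v \ Y).ncard := by gcongr
              _ = _ := mul_comm _ _
          have h2 : ((unresolved X (Y ∪ confirmed X u v)).ncard : ℝ) +
            (confirmed X u v \ Y).ncard = m := by exact_mod_cast hcard
          linarith
        push_cast
        linarith
      · have hlen' : (O.path u v).length ≠ X.dist u v := by
          rwa [SimpleGraph.Walk.length_edges] at hlen
        obtain ⟨hmem, hnot⟩ := r.pickEdge_spec X Y (O.path u v).edges
          (exists_edge_notMem_of_dist_ne hXG hX _ (O.length_path u v) hlen')
        set e := r.pickEdge X Y (O.path u v).edges with he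
        have hnext : (greedy r).next (⟨[], X, Y⟩ : GreedyState V) (O.path u v).edges =
            (⟨[], X ⊔ SimpleGraph.fromEdgeSet {e}, Y⟩ : GreedyState V) := by
          simp only [greedy]
          rw [if_neg hlen]
        have heG : e ∈ G.edgeSet := SimpleGraph.Walk.edges_subset_edgeSet _ hmem
        have hediag : ¬ e.IsDiag := SimpleGraph.not_isDiag_of_mem_edgeSet _ heG
        set X' := X ⊔ SimpleGraph.fromEdgeSet {e} with hX'
        have hE : X'.edgeSet = insert e X.edgeSet := by
          rw [hX', SimpleGraph.edgeSet_sup, SimpleGraph.edgeSet_fromEdgeSet]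
          ext x
          simp only [Set.mem_union, Set.mem_sdiff, Set.mem_singleton_iff, Set.mem_insert_iff]
          constructor
          · tauto
          · rintro (rfl | h)
            · exact Or.inr ⟨rfl, hediag⟩
            · exact Or.inl h
        have hX'G : X' ≤ G := by
          rw [← SimpleGraph.edgeSet_subset_edgeSet, hE]
          exact Set.insert_subset heG (SimpleGraph.edgeSet_subset_edgeSet.2 hXG)
        -- The pair `e` itself stops being unresolved; it was not in `Y` because `Y` contains no
        -- edge of `G`.
        have hlt : (unresolved X' Y).ncard < m := by
          rw [← hm]
          refine Set.ncard_lt_ncard ?_ (Set.toFinite _)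
          refine ⟨fun x hx => ⟨hx.1, fun h => hx.2.1 ?_, hx.2.2⟩, fun h => ?_⟩
          · rw [hE]; exact Set.mem_insert_of_mem _ h
          · have : e ∈ unresolved X' Y :=
              h ⟨hediag, hnot, fun hy => Set.disjoint_left.1 hY hy heG⟩
            apply this.2.1
            rw [hE]; exact Set.mem_insert _ _
        obtain ⟨q, hq, hqb⟩ := ih _ hlt X' Y (hX.mono le_sup_left) hX'G hY rfl
        refine ⟨q + 1, QueryAlgorithm.Run.ask hact (by rw [hnext]; exact hq), ?_⟩
        have h1 : (G.edgeSet \ X'.edgeSet).ncard + 1 = (G.edgeSet \ X.edgeSet).ncard := by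
          have : G.edgeSet \ X'.edgeSet = (G.edgeSet \ X.edgeSet) \ {e} := by
            rw [hE]; ext x
            simp only [Set.mem_sdiff, Set.mem_insert_iff, Set.mem_singleton_iff]
            tauto
          rw [this]
          exact Set.ncard_sdiff_singleton_add_one ⟨heG, hnot⟩ (Set.toFinite _)
        have h2 := decayBound_mono hNpos.le hlt.le
        have h3 : ((G.edgeSet \ X'.edgeSet).ncard : ℝ) + 1 = (G.edgeSet \ X.edgeSet).ncard := by
          exact_mod_cast h1
        push_cast
        linarith

/-- Loop invariant: every vertex is still pending or already joined to the root in `X`, so `X` is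
connected when the loop ends. -/
theorem run_of_pending {V : Type u} [Fintype V] (r : GreedyRule V) {G : SimpleGraph V}
    (O : ShortestPathOracle G) {b : ℝ}
    (hb : ∀ X : SimpleGraph V, X.Connected → X ≤ G → ∃ q : ℕ,
      (greedy r).Run O (⟨[], X, ∅⟩ : GreedyState V) q G ∧ (q : ℝ) ≤ b) :
    ∀ (l : List V) (X : SimpleGraph V), X ≤ G →
      (∀ w, w ∈ l ∨ X.Reachable w r.root) →
      ∃ q : ℕ, (greedy r).Run O (⟨l, X, ∅⟩ : GreedyState V) q G ∧ (q : ℝ) ≤ l.length + b := by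
  intro l
  induction l with
  | nil =>
    intro X hXG hw
    have hX : X.Connected := by
      refine (SimpleGraph.connected_iff_exists_forall_reachable X).2 ⟨r.root, fun w => ?_⟩
      rcases hw w with h | h
      · simp at h
      · exact h.symm
    simpa using hb X hX hXG
  | cons w l ih =>
    intro X hXG hw
    set p := O.path w r.root with hp
    set X' := X ⊔ SimpleGraph.fromEdgeSet {e | e ∈ p.edges} with hX'
    have hX'G : X' ≤ G := by
      refine sup_le hXG fun a b hab => ?_
      rw [SimpleGraph.fromEdgeSet_adj] at hab
      exact SimpleGraph.Walk.edges_subset_edgeSet p hab.1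
    have hreach : X'.Reachable w r.root := by
      refine ⟨p.transfer X' fun e he => ?_⟩
      rw [hX', SimpleGraph.edgeSet_sup, SimpleGraph.edgeSet_fromEdgeSet]
      exact Or.inr ⟨he, SimpleGraph.not_isDiag_of_mem_edgeSet _
        (SimpleGraph.Walk.edges_subset_edgeSet p he)⟩
    obtain ⟨q, hq, hqb⟩ := ih X' hX'G fun x => by
      rcases hw x with h | h
      · rcases List.mem_cons.1 h with rfl | h
        · exact Or.inr hreach
        · exact Or.inl h
      · exact Or.inr (h.mono le_sup_left)
    refine ⟨q + 1, QueryAlgorithm.Run.ask (u := w) (v := r.root) rfl hq, ?_⟩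
    push_cast [List.length_cons]
    linarith

theorem GreedyRule.length_order {V : Type u} [Fintype V] (r : GreedyRule V) :
    r.order.length + 1 = Fintype.card V := by
  classical
  have h : r.order.toFinset = Finset.univ.erase r.root := by
    ext x
    simp [r.mem_order]
  have h2 := congrArg Finset.card h
  rw [List.toFinset_card_of_nodup r.nodup_order, Finset.card_erase_of_mem (Finset.mem_univ _),
    Finset.card_univ] at h2
  have := Fintype.card_pos_iff.2 ⟨r.root⟩
  omega

/-- The number of queries of the greedy algorithm, in terms of the size of the covers of the
connected subgraphs of `G`. -/
theorem reconstructsWithin_of_cover {V : Type u} [Fintype V] (r : GreedyRule V)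
    {G : SimpleGraph V} [DecidableRel G.Adj] {N : ℝ} (hN0 : 0 ≤ N)
    (hN : ∀ X : SimpleGraph V, X.Connected → X ≤ G →
      ∃ T : Finset (V × V), IsCover X Finset.univ T ∧ (T.card : ℝ) ≤ N) :
    (greedy r).ReconstructsWithin G ((Fintype.card V - 1 : ℝ) + Fintype.card V * G.maxDegree +
      decayBound N (Fintype.card V * (Fintype.card V - 1))) := by
  intro O
  have hcard : ∀ X : SimpleGraph V, (unresolved X ∅).ncard ≤
      Fintype.card V * (Fintype.card V - 1) := by
    classical
    intro X
    have hsub : unresolved X ∅ ⊆ (fun p : V × V => s(p.1, p.2)) ''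
        ((Finset.univ : Finset V).offDiag : Set (V × V)) := by
      intro e he
      induction e using Sym2.ind with
      | _ a b => exact ⟨(a, b), by simpa using he.1, rfl⟩
    calc (unresolved X ∅).ncard ≤ _ := Set.ncard_le_ncard hsub (Set.toFinite _)
      _ ≤ _ := Set.ncard_image_le (Set.toFinite _)
      _ = Fintype.card V * (Fintype.card V - 1) := by
        rw [Set.ncard_coe_finset, Finset.offDiag_card, Finset.card_univ, Nat.mul_sub, mul_one]
  have hedges : (G.edgeSet.ncard : ℝ) ≤ Fintype.card V * G.maxDegree := by
    classical
    have h1 : G.edgeSet.ncard = G.edgeFinset.card := by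
      rw [← SimpleGraph.coe_edgeFinset, Set.ncard_coe_finset]
    have h2 := G.sum_degrees_eq_twice_card_edges
    have h3 : ∑ v, G.degree v ≤ ∑ _v : V, G.maxDegree :=
      Finset.sum_le_sum fun v _ => G.degree_le_maxDegree v
    simp only [Finset.sum_const, Finset.card_univ, smul_eq_mul] at h3
    have h4 : G.edgeSet.ncard ≤ Fintype.card V * G.maxDegree := by omega
    exact_mod_cast h4
  have hmain := run_of_pending r O (b := Fintype.card V * G.maxDegree +
      decayBound N (Fintype.card V * (Fintype.card V - 1))) (fun X hX hXG => by
    obtain ⟨q, hq, hqb⟩ := run_of_pending_nil r O hN _ X ∅ hX hXG (Set.empty_disjoint _) rfl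
    refine ⟨q, hq, hqb.trans (add_le_add (le_trans ?_ hedges) (decayBound_mono hN0 (hcard X)))⟩
    exact_mod_cast Set.ncard_le_ncard Set.sdiff_subset (Set.toFinite _))
    r.order ⊥ bot_le fun w => by
      by_cases h : w = r.root
      · subst h; exact Or.inr (SimpleGraph.Reachable.refl _)
      · exact Or.inl ((r.mem_order w).2 h)
  obtain ⟨q, hq, hqb⟩ := hmain
  refine ⟨q, hq, hqb.trans (le_of_eq ?_)⟩
  have : (r.order.length : ℝ) + 1 = Fintype.card V := by exact_mod_cast r.length_order
  linarith

theorem nonempty_greedyRule (V : Type u) [Fintype V] [Nonempty V] : Nonempty (GreedyRule V) := by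
  classical
  have hpick : ∀ (X : SimpleGraph V) (Y : Set (Sym2 V)), ∃ p : V × V, ∀ u v : V,
      (confirmed X u v \ Y).ncard ≤ (confirmed X p.1 p.2 \ Y).ncard := fun X Y => by
    obtain ⟨p, hp⟩ := Finite.exists_max fun p : V × V => (confirmed X p.1 p.2 \ Y).ncard
    exact ⟨p, fun u v => hp (u, v)⟩
  choose pick hpick using hpick
  have hedge : ∀ (X : SimpleGraph V) (_ : Set (Sym2 V)) (p : List (Sym2 V)), ∃ e : Sym2 V,
      (∃ e ∈ p, e ∉ X.edgeSet) → e ∈ p ∧ e ∉ X.edgeSet := fun X _ p => by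
    by_cases h : ∃ e ∈ p, e ∉ X.edgeSet
    · obtain ⟨e, he⟩ := h
      exact ⟨e, fun _ => he⟩
    · exact ⟨s(Classical.arbitrary V, Classical.arbitrary V), fun h' => absurd h' h⟩
  choose pickEdge hedge using hedge
  exact ⟨{ root := Classical.arbitrary V
           order := (Finset.univ.erase (Classical.arbitrary V)).toList
           nodup_order := Finset.nodup_toList _
           mem_order := by simp
           pick := pick
           pick_max := hpick
           pickEdge := pickEdge
           pickEdge_spec := hedge }⟩

/-! ### Centers that make all clusters small -/

open Classical in
/-- The vertices of `U` that are closer to `w` than to every vertex of `A`. -/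
noncomputable def cluster {V : Type u} (X : SimpleGraph V) (U A : Finset V) (w : V) : Finset V :=
  {v ∈ U | ∀ a ∈ A, X.dist w v < X.dist a v}

theorem mem_cluster {V : Type u} {X : SimpleGraph V} {U A : Finset V} {w v : V} :
    v ∈ cluster X U A w ↔ v ∈ U ∧ ∀ a ∈ A, X.dist w v < X.dist a v := by
  simp [cluster]

theorem cluster_anti {V : Type u} (X : SimpleGraph V) (U : Finset V) {A B : Finset V}
    (h : A ⊆ B) (w : V) : cluster X U B w ⊆ cluster X U A w := by
  intro v hv
  rw [mem_cluster] at hv ⊢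
  exact ⟨hv.1, fun a ha => hv.2 a (h ha)⟩

/-- For two elements $w,a$ at most one of $f(w)<f(a)$ and $f(a)<f(w)$ holds, so at most half of the
ordered pairs are counted. -/
theorem two_mul_sum_card_filter_lt_le {α : Type*} [DecidableEq α] (B : Finset α) (f : α → ℕ) :
    2 * ∑ a ∈ B, {w ∈ B | f w < f a}.card ≤ B.card ^ 2 := by
  have h1 : ∑ a ∈ B, {w ∈ B | f w < f a}.card = ∑ a ∈ B, {w ∈ B | f a < f w}.card := by
    simp only [Finset.card_filter]
    exact Finset.sum_comm
  calc 2 * ∑ a ∈ B, {w ∈ B | f w < f a}.card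
      = ∑ a ∈ B, ({w ∈ B | f w < f a}.card + {w ∈ B | f a < f w}.card) := by
        rw [Finset.sum_add_distrib, ← h1, two_mul]
    _ ≤ ∑ _a ∈ B, B.card := by
        refine Finset.sum_le_sum fun a _ => ?_
        rw [← Finset.card_union_of_disjoint]
        · exact Finset.card_le_card
            (Finset.union_subset (Finset.filter_subset _ _) (Finset.filter_subset _ _))
        · rw [Finset.disjoint_left]
          intro w h2 h3
          have h4 := (Finset.mem_filter.1 h2).2
          have h5 := (Finset.mem_filter.1 h3).2
          omega
    _ = B.card ^ 2 := by simp [sq]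

/-- Elements $a\in W\setminus B$ contribute at most $|B|$ each, and
$2(|W|-|B|)|B|+|B|^2=2|W||B|-|B|^2$. -/
theorem two_mul_sum_card_filter_lt_le_of_subset {α : Type*} [DecidableEq α] {B W : Finset α}
    (h : B ⊆ W) (f : α → ℕ) :
    2 * (∑ a ∈ W, ({w ∈ B | f w < f a}.card : ℝ)) ≤ 2 * W.card * B.card - B.card ^ 2 := by
  have h1 := two_mul_sum_card_filter_lt_le B f
  have h2 : ∑ a ∈ W \ B, {w ∈ B | f w < f a}.card ≤ (W \ B).card * B.card := by
    rw [← smul_eq_mul]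
    exact Finset.sum_le_card_nsmul _ _ _ fun a _ => Finset.card_le_card (Finset.filter_subset _ _)
  have h3 : (W \ B).card + B.card = W.card := Finset.card_sdiff_add_card_eq_card h
  have h4 := Finset.sum_sdiff h (f := fun a => ({w ∈ B | f w < f a}.card : ℝ))
  have h1' : 2 * ∑ a ∈ B, ({w ∈ B | f w < f a}.card : ℝ) ≤ (B.card : ℝ) ^ 2 := by exact_mod_cast h1
  have h2' : ∑ a ∈ W \ B, ({w ∈ B | f w < f a}.card : ℝ) ≤ ((W \ B).card : ℝ) * B.card := by
    exact_mod_cast h2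
  have h3' : ((W \ B).card : ℝ) = W.card - B.card := by
    rw [← h3]; push_cast; ring
  rw [h3'] at h2'
  rw [← h4]
  linarith

open Classical in
/-- The vertices whose cluster is larger than a fraction `1 / s` of `U`. -/
noncomputable def bigCenters {V : Type u} [Fintype V] (X : SimpleGraph V) (U A : Finset V)
    (s : ℝ) : Finset V :=
  {w | (U.card : ℝ) < (cluster X U A w).card * s}

theorem mem_bigCenters {V : Type u} [Fintype V] {X : SimpleGraph V} {U A : Finset V} {s : ℝ}
    {w : V} : w ∈ bigCenters X U A s ↔ (U.card : ℝ) < (cluster X U A w).card * s := by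
  simp [bigCenters]

/-- The total size of the clusters that are too large. -/
noncomputable def clusterPotential {V : Type u} [Fintype V] (X : SimpleGraph V) (U A : Finset V)
    (s : ℝ) : ℕ :=
  ∑ w ∈ bigCenters X U A s, (cluster X U A w).card

theorem sum_card_cluster {V : Type u} [DecidableEq V] (X : SimpleGraph V) (U A W : Finset V) :
    ∑ w ∈ W, (cluster X U A w).card =
      ∑ v ∈ U, {w ∈ W | ∀ a ∈ A, X.dist w v < X.dist a v}.card := by
  classical
  simp only [cluster, Finset.card_filter]
  exact Finset.sum_comm

/-- Average over $a$ in the set $W$ of big centers. If $B_v$ is the set of $w\in W$ whose cluster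
contains $v$, then $w$ keeps $v$ only if it is closer to $v$ than $a$ is, so $v$ loses at least
$|B_v|^2/(2|W|)$ on average. Cauchy–Schwarz gives $\sum_v|B_v|^2\ge P^2/|U|$, and $P\ge|W||U|/s$
because the clusters are big; the average loss is therefore at least $P/(2s)$. -/
theorem exists_insert_clusterPotential_le {V : Type u} [Fintype V] [DecidableEq V]
    (X : SimpleGraph V) (U A : Finset V) {s : ℝ} (hs : 0 < s)
    (h : 0 < clusterPotential X U A s) :
    ∃ a, (clusterPotential X U (insert a A) s : ℝ) ≤
      clusterPotential X U A s - clusterPotential X U A s / (2 * s) := by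
  classical
  set W := bigCenters X U A s with hW
  set P := clusterPotential X U A s with hP
  set B : V → Finset V := fun v => {w ∈ W | ∀ a ∈ A, X.dist w v < X.dist a v} with hB
  have hPB : P = ∑ v ∈ U, (B v).card := by
    rw [hP, clusterPotential, ← hW, sum_card_cluster]
    refine Finset.sum_congr rfl fun v _ => ?_
    simp only [hB]
    congr
  have hWne : W.Nonempty := by
    by_contra hne
    rw [Finset.not_nonempty_iff_eq_empty] at hne
    simp [hP, clusterPotential, ← hW, hne] at h
  have hUpos : 0 < U.card := by
    by_contra h0
    have hU0 : U = ∅ := by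
      rw [← Finset.card_eq_zero]; omega
    rw [hPB, hU0] at h
    simp at h
  have hsucc : ∀ a, clusterPotential X U (insert a A) s ≤
      ∑ v ∈ U, {w ∈ B v | X.dist w v < X.dist a v}.card := by
    intro a
    have hsub : bigCenters X U (insert a A) s ⊆ W := by
      intro w hw
      rw [hW]
      rw [mem_bigCenters] at hw ⊢
      refine hw.trans_le ?_
      have := Finset.card_le_card (cluster_anti X U (Finset.subset_insert a A) w)
      gcongr
    calc clusterPotential X U (insert a A) s
        ≤ ∑ w ∈ W, (cluster X U (insert a A) w).card :=
          Finset.sum_le_sum_of_subset hsub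
      _ = _ := sum_card_cluster X U (insert a A) W
      _ = ∑ v ∈ U, {w ∈ B v | X.dist w v < X.dist a v}.card := by
        refine Finset.sum_congr rfl fun v _ => ?_
        congr 1
        ext w
        simp only [hB, Finset.mem_filter, Finset.forall_mem_insert]
        tauto
  have hcs : (P : ℝ) ^ 2 ≤ U.card * ∑ v ∈ U, ((B v).card : ℝ) ^ 2 := by
    rw [hPB]
    push_cast
    exact sq_sum_le_card_mul_sum_sq
  have hlow : (W.card : ℝ) * U.card ≤ P * s := by
    rw [hP, clusterPotential, ← hW]
    push_cast
    rw [Finset.sum_mul, ← nsmul_eq_mul]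
    exact Finset.card_nsmul_le_sum _ _ _ fun w hw => (mem_bigCenters.1 hw).le
  have hsum : 2 * ∑ a ∈ W, ∑ v ∈ U, ({w ∈ B v | X.dist w v < X.dist a v}.card : ℝ) ≤
      2 * W.card * P - ∑ v ∈ U, ((B v).card : ℝ) ^ 2 := by
    rw [Finset.sum_comm, hPB, Finset.mul_sum]
    push_cast
    rw [Finset.mul_sum, ← Finset.sum_sub_distrib]
    exact Finset.sum_le_sum fun v _ =>
      two_mul_sum_card_filter_lt_le_of_subset (Finset.filter_subset _ _) fun w => X.dist w v
  have hUr : (0 : ℝ) < U.card := by exact_mod_cast hUpos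
  have hPr : (0 : ℝ) < P := by exact_mod_cast h
  have hsq : (W.card : ℝ) * P / s ≤ ∑ v ∈ U, ((B v).card : ℝ) ^ 2 := by
    rw [div_le_iff₀ hs]
    have h1 : (W.card : ℝ) * U.card * P ≤ U.card * ((∑ v ∈ U, ((B v).card : ℝ) ^ 2) * s) := by
      calc (W.card : ℝ) * U.card * P ≤ P * s * P := by gcongr
        _ = P ^ 2 * s := by ring
        _ ≤ (U.card * ∑ v ∈ U, ((B v).card : ℝ) ^ 2) * s := by gcongr
        _ = _ := by ring
    have h2 : (U.card : ℝ) * (W.card * P) ≤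
        U.card * ((∑ v ∈ U, ((B v).card : ℝ) ^ 2) * s) := by linarith
    exact le_of_mul_le_mul_left h2 hUr
  have hfin : ∑ a ∈ W, ∑ v ∈ U, ({w ∈ B v | X.dist w v < X.dist a v}.card : ℝ) ≤
      ∑ _a ∈ W, ((P : ℝ) - P / (2 * s)) := by
    rw [Finset.sum_const, nsmul_eq_mul]
    have : (W.card : ℝ) * (P - P / (2 * s)) = (2 * W.card * P - W.card * P / s) / 2 := by
      field_simp
    rw [this]
    linarith
  obtain ⟨a, -, ha⟩ := Finset.exists_le_of_sum_le hWne hfin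
  refine ⟨a, le_trans ?_ ha⟩
  exact_mod_cast hsucc a

/-- Centers are added until the potential vanishes; a cluster that is still too large would be
nonempty and contribute to it. -/
theorem exists_superset_forall_card_cluster_le {V : Type u} [Fintype V] [DecidableEq V]
    (X : SimpleGraph V) (U : Finset V) {s : ℝ} (hs : 0 < s) :
    ∀ (m : ℕ) (A : Finset V), clusterPotential X U A s = m → ∃ A' : Finset V, A ⊆ A' ∧
      (∀ w, ((cluster X U A' w).card : ℝ) * s ≤ U.card) ∧
      (A'.card : ℝ) ≤ A.card + decayBound (2 * s) m := by
  intro m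
  induction m using Nat.strong_induction_on with
  | _ m ih =>
    intro A hA
    rcases Nat.eq_zero_or_pos m with rfl | hm
    · refine ⟨A, subset_rfl, fun w => ?_, by simp [decayBound_zero]⟩
      by_contra hw
      push Not at hw
      have h1 : (cluster X U A w).card ≤ clusterPotential X U A s :=
        Finset.single_le_sum (f := fun w => (cluster X U A w).card) (fun _ _ => Nat.zero_le _)
          (mem_bigCenters.2 hw)
      have h2 : (cluster X U A w).card = 0 := by omega
      rw [h2] at hw
      have : (0 : ℝ) ≤ U.card := by positivity
      norm_num at hw
      linarith
    · obtain ⟨a, ha⟩ := exists_insert_clusterPotential_le X U A hs (by omega)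
      rw [hA] at ha
      have hmr : (0 : ℝ) < m := by exact_mod_cast hm
      have hlt : clusterPotential X U (insert a A) s < m := by
        have : (0 : ℝ) < m / (2 * s) := by positivity
        have h2 : (clusterPotential X U (insert a A) s : ℝ) < m := by linarith
        exact_mod_cast h2
      obtain ⟨A', hAA', hcl, hcard⟩ := ih _ hlt (insert a A) rfl
      refine ⟨A', (Finset.subset_insert a A).trans hAA', hcl, ?_⟩
      have h1 := decayBound_step (by positivity : 0 < 2 * s) hm ha
      have h2 : ((insert a A).card : ℝ) ≤ A.card + 1 := by
        exact_mod_cast Finset.card_insert_le a A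
      linarith

/-- A small nonempty set of centers that makes all clusters small. -/
theorem exists_centers {V : Type u} [Fintype V] [Nonempty V] (X : SimpleGraph V)
    (U : Finset V) {s : ℝ} (hs : 0 < s) :
    ∃ A : Finset V, A.Nonempty ∧ (∀ w, ((cluster X U A w).card : ℝ) * s ≤ U.card) ∧
      (A.card : ℝ) ≤ 2 + 4 * s * Real.log (Fintype.card V) := by
  classical
  obtain ⟨v⟩ := ‹Nonempty V›
  obtain ⟨A, hA, hcl, hcard⟩ := exists_superset_forall_card_cluster_le X U hs _ {v} rfl
  refine ⟨A, ⟨v, hA (by simp)⟩, hcl, hcard.trans ?_⟩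
  have hpos : 0 < Fintype.card V := Fintype.card_pos_iff.2 ⟨v⟩
  -- The potential starts at no more than $n^2$, which gives $2s\log n^2=4s\log n$; the 2 in the
  -- bound is the starting center plus the 1 in `decayBound`.
  have hP : clusterPotential X U {v} s ≤ Fintype.card V * Fintype.card V := by
    unfold clusterPotential
    calc _ ≤ (bigCenters X U {v} s).card • Fintype.card V :=
          Finset.sum_le_card_nsmul _ _ _ fun w _ => Finset.card_le_univ _
      _ ≤ Fintype.card V * Fintype.card V := by
          rw [smul_eq_mul]
          exact Nat.mul_le_mul_right _ (Finset.card_le_univ _)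
  have h1 := decayBound_mono (by positivity : 0 ≤ 2 * s) hP
  rw [decayBound_of_pos _ (Nat.mul_pos hpos hpos)] at h1
  push_cast at h1
  have h0 : (Fintype.card V : ℝ) ≠ 0 := by exact_mod_cast hpos.ne'
  rw [Real.log_mul h0 h0] at h1
  simp only [Finset.card_singleton, Nat.cast_one]
  linarith

/-! ### Covers by recursion on clusters -/

theorem exists_adj_dist_eq {V : Type u} {X : SimpleGraph V} {a x : V} {d : ℕ}
    (h : X.dist a x = d + 1) : ∃ b, X.Adj a b ∧ X.dist b x = d := by
  obtain ⟨p, hp⟩ := SimpleGraph.exists_walk_of_dist_ne_zero (by omega : X.dist a x ≠ 0)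
  cases p with
  | nil => simp at h
  | @cons _ b _ hab q =>
    refine ⟨b, hab, ?_⟩
    rw [SimpleGraph.Walk.length_cons] at hp
    have h1 : X.dist b x ≤ q.length := SimpleGraph.dist_le q
    have h2 : X.dist a x ≤ X.dist a b + X.dist b x := hab.reachable.dist_triangle_left x
    rw [SimpleGraph.dist_eq_one_iff_adj.2 hab] at h2
    omega

open Classical in
/-- The vertices at distance at most two. -/
noncomputable def ballTwo {V : Type u} [Fintype V] (X : SimpleGraph V) (a : V) : Finset V :=
  {b | X.dist a b ≤ 2}

theorem mem_ballTwo {V : Type u} [Fintype V] {X : SimpleGraph V} {a b : V} :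
    b ∈ ballTwo X a ↔ X.dist a b ≤ 2 := by
  simp [ballTwo]

open Classical in
theorem card_ballTwo_le {V : Type u} [Fintype V] {X : SimpleGraph V} (hX : X.Connected) {D : ℕ}
    (hD : ∀ v, (Finset.univ.filter (X.Adj v)).card ≤ D) (a : V) :
    (ballTwo X a).card ≤ 1 + D + D ^ 2 := by
  have hsub : ballTwo X a ⊆ ({a} ∪ Finset.univ.filter (X.Adj a)) ∪
      (Finset.univ.filter (X.Adj a)).biUnion fun c => Finset.univ.filter (X.Adj c) := by
    intro b hb
    rw [mem_ballTwo] at hb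
    simp only [Finset.mem_union, Finset.mem_singleton, Finset.mem_filter, Finset.mem_univ,
      true_and, Finset.mem_biUnion]
    interval_cases h : X.dist a b
    · exact Or.inl (Or.inl (hX.dist_eq_zero_iff.1 h).symm)
    · exact Or.inl (Or.inr (SimpleGraph.dist_eq_one_iff_adj.1 h))
    · obtain ⟨c, hc, hcb⟩ := exists_adj_dist_eq (d := 1) h
      exact Or.inr ⟨c, hc, SimpleGraph.dist_eq_one_iff_adj.1 hcb⟩
  have h2 : ((Finset.univ.filter (X.Adj a)).biUnion
      fun c => Finset.univ.filter (X.Adj c)).card ≤ D * D :=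
    (Finset.card_biUnion_le_card_mul _ _ _ fun c _ => hD c).trans (Nat.mul_le_mul_right _ (hD a))
  calc (ballTwo X a).card ≤ _ := Finset.card_le_card hsub
    _ ≤ _ := Finset.card_union_le _ _
    _ ≤ (1 + D) + D * D :=
        add_le_add ((Finset.card_union_le _ _).trans (by simpa using hD a)) h2
    _ = 1 + D + D ^ 2 := by ring

/-- Two non-adjacent vertices are confirmed by a query of a vertex near the centers or lie in a
common cluster of such a vertex. -/
theorem exists_confirmed_or_mem_cluster {V : Type u} {X : SimpleGraph V}
    (hX : X.Connected) {U A : Finset V} {x y a : V} (hx : x ∈ U) (hy : y ∈ U)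
    (hxy : x ≠ y) (hadj : ¬ X.Adj x y) (hax : ∀ a' ∈ A, X.dist a x ≤ X.dist a' x)
    (hay : ∀ a' ∈ A, X.dist a x ≤ X.dist a' y) :
    ∃ b, X.dist a b ≤ 2 ∧ (s(x, y) ∈ confirmed X b y ∨
      (x ∈ cluster X U A b ∧ y ∈ cluster X U A b)) := by
  by_cases hd : X.dist a x ≤ 1
  · exact ⟨x, by omega, Or.inl (mem_confirmed_self hX hxy hadj)⟩
  -- Let $b$ be two steps from $a$ towards $x$. If $(b,y)$ does not confirm, then
  -- $\delta(b,y)\le\delta(b,x)+1=\delta(a,x)-1$, which is strictly below the distance from $y$ to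
  -- any center. One step would not give strictness.
  · obtain ⟨d, hd2⟩ : ∃ d, X.dist a x = d + 1 + 1 := ⟨X.dist a x - 2, by omega⟩
    obtain ⟨c, hac, hc⟩ := exists_adj_dist_eq hd2
    obtain ⟨b, hcb, hb⟩ := exists_adj_dist_eq hc
    have hab : X.dist a b ≤ 2 := by
      have h1 : X.dist a b ≤ X.dist a c + X.dist c b := hX.dist_triangle
      rw [SimpleGraph.dist_eq_one_iff_adj.2 hac, SimpleGraph.dist_eq_one_iff_adj.2 hcb] at h1
      exact h1
    refine ⟨b, hab, ?_⟩
    by_cases hby : X.dist b x + 1 < X.dist b y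
    · exact Or.inl (mem_confirmed_right hxy hadj hby)
    · right
      simp only [mem_cluster]
      refine ⟨⟨hx, fun a' ha' => ?_⟩, ⟨hy, fun a' ha' => ?_⟩⟩
      · have := hax a' ha'; omega
      · have := hay a' ha'; omega

/-- The endpoint nearer to `A` plays the role of $x$ in `exists_confirmed_or_mem_cluster`; pairs
inside a common cluster are left to `T`. -/
theorem isCover_step {V : Type u} [Fintype V] [DecidableEq V] {X : SimpleGraph V}
    (hX : X.Connected) {U A : Finset V} (hA : A.Nonempty) (T : V → Finset (V × V))
    (hT : ∀ b, IsCover X (cluster X U A b) (T b)) :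
    IsCover X U ((A.biUnion (ballTwo X)) ×ˢ U ∪ (A.biUnion (ballTwo X)).biUnion T) := by
  have key : ∀ x ∈ U, ∀ y ∈ U, x ≠ y → ¬ X.Adj x y → ∀ a ∈ A,
      (∀ a' ∈ A, X.dist a x ≤ X.dist a' x) → (∀ a' ∈ A, X.dist a x ≤ X.dist a' y) →
      ∃ p ∈ (A.biUnion (ballTwo X)) ×ˢ U ∪ (A.biUnion (ballTwo X)).biUnion T,
        s(x, y) ∈ confirmed X p.1 p.2 := by
    intro x hx y hy hxy hadj a ha hax hay
    obtain ⟨b, hab, hb⟩ := exists_confirmed_or_mem_cluster hX hx hy hxy hadj hax hay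
    have hbB : b ∈ A.biUnion (ballTwo X) := Finset.mem_biUnion.2 ⟨a, ha, mem_ballTwo.2 hab⟩
    rcases hb with hb | ⟨h1, h2⟩
    · exact ⟨(b, y), Finset.mem_union_left _ (Finset.mk_mem_product hbB hy), hb⟩
    · obtain ⟨p, hp, hpc⟩ := hT b x h1 y h2 hxy hadj
      exact ⟨p, Finset.mem_union_right _ (Finset.mem_biUnion.2 ⟨b, hbB, hp⟩), hpc⟩
  intro x hx y hy hxy hadj
  obtain ⟨a, ha, hax⟩ := A.exists_min_image (fun a => X.dist a x) hA
  obtain ⟨c, hc, hcy⟩ := A.exists_min_image (fun a => X.dist a y) hA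
  rcases le_total (X.dist a x) (X.dist c y) with h | h
  · exact key x hx y hy hxy hadj a ha hax fun a' ha' => h.trans (hcy a' ha')
  · rw [Sym2.eq_swap]
    exact key y hy x hx hxy.symm (fun h' => hadj h'.symm) c hc hcy
      fun a' ha' => h.trans (hax a' ha')

-- With at most $M$ vertices near the centers, one level costs $M|U|$ queries plus $M$ recursive
-- calls on sets of size at most $|U|/s$. The stated bound dominates the solution of this
-- recurrence.
open Classical in
theorem exists_isCover_of_card_le_pow {V : Type u} [Fintype V] {X : SimpleGraph V}
    (hX : X.Connected) {D : ℕ} (hD : ∀ v, (Finset.univ.filter (X.Adj v)).card ≤ D)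
    {s M : ℝ} (hs : 0 < s)
    (hM : (1 + D + D ^ 2 : ℝ) * (2 + 4 * s * Real.log (Fintype.card V)) ≤ M) (k : ℕ) :
    ∀ U : Finset V, (U.card : ℝ) ≤ s ^ k → ∃ T : Finset (V × V), IsCover X U T ∧
      (T.card : ℝ) ≤ s * ((M / s + 1) ^ k - 1) * U.card := by
  have hne : Nonempty V := hX.nonempty
  have hlog := Real.log_natCast_nonneg (Fintype.card V)
  have hM0 : 0 ≤ M := le_trans (by positivity) hM
  induction k with
  | zero =>
    intro U hU
    refine ⟨∅, fun a ha b hb hab => ?_, by simp⟩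
    rw [pow_zero] at hU
    exact absurd (Finset.card_le_one.1 (by exact_mod_cast hU) a ha b hb) hab
  | succ k ih =>
    intro U hU
    obtain ⟨A, hA, hcl, hcard⟩ := exists_centers X U hs
    have hcl' : ∀ b, ((cluster X U A b).card : ℝ) ≤ U.card / s := fun b => by
      rw [le_div_iff₀ hs]; exact hcl b
    have hTex : ∀ b, ∃ T : Finset (V × V), IsCover X (cluster X U A b) T ∧
        (T.card : ℝ) ≤ s * ((M / s + 1) ^ k - 1) * (cluster X U A b).card := fun b => by
      refine ih _ ((hcl' b).trans ?_)
      rw [div_le_iff₀ hs, ← pow_succ]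
      exact hU
    choose T hTc hTn using hTex
    refine ⟨_, isCover_step hX hA T hTc, ?_⟩
    have hq : 0 ≤ (M / s + 1) ^ k - 1 := by
      have : (1 : ℝ) ≤ (M / s + 1) ^ k := one_le_pow₀ (by
        have : 0 ≤ M / s := by positivity
        linarith)
      linarith
    have hB : ((A.biUnion (ballTwo X)).card : ℝ) ≤ M := by
      have h1 : (A.biUnion (ballTwo X)).card ≤ A.card * (1 + D + D ^ 2) :=
        Finset.card_biUnion_le_card_mul _ _ _ fun a _ => card_ballTwo_le hX hD a
      calc ((A.biUnion (ballTwo X)).card : ℝ) ≤ A.card * (1 + D + D ^ 2) := by exact_mod_cast h1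
        _ ≤ (2 + 4 * s * Real.log (Fintype.card V)) * (1 + D + D ^ 2) := by gcongr
        _ ≤ M := by linarith
    have hTb : ∀ b, ((T b).card : ℝ) ≤ ((M / s + 1) ^ k - 1) * U.card := fun b => by
      calc ((T b).card : ℝ) ≤ s * ((M / s + 1) ^ k - 1) * (cluster X U A b).card := hTn b
        _ ≤ s * ((M / s + 1) ^ k - 1) * (U.card / s) := by
          have := hcl' b
          gcongr
        _ = _ := by field_simp
    have hTs : (((A.biUnion (ballTwo X)).biUnion T).card : ℝ) ≤
        (A.biUnion (ballTwo X)).card * (((M / s + 1) ^ k - 1) * U.card) := by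
      calc (((A.biUnion (ballTwo X)).biUnion T).card : ℝ)
          ≤ ∑ b ∈ A.biUnion (ballTwo X), ((T b).card : ℝ) := by
            exact_mod_cast Finset.card_biUnion_le
        _ ≤ _ := by
            rw [← nsmul_eq_mul]
            exact Finset.sum_le_card_nsmul _ _ _ fun b _ => hTb b
    calc (((A.biUnion (ballTwo X)) ×ˢ U ∪ (A.biUnion (ballTwo X)).biUnion T).card : ℝ)
        ≤ ((A.biUnion (ballTwo X)) ×ˢ U).card + ((A.biUnion (ballTwo X)).biUnion T).card := by
          exact_mod_cast Finset.card_union_le _ _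
      _ ≤ (A.biUnion (ballTwo X)).card * U.card +
          (A.biUnion (ballTwo X)).card * (((M / s + 1) ^ k - 1) * U.card) := by
          rw [Finset.card_product]
          push_cast
          gcongr
      _ = (A.biUnion (ballTwo X)).card * ((M / s + 1) ^ k * U.card) := by ring
      _ ≤ M * ((M / s + 1) ^ k * U.card) := by gcongr
      _ = s * ((M / s + 1) ^ (k + 1) - (M / s + 1) ^ k) * U.card := by
          rw [pow_succ]; field_simp; ring
      _ ≤ s * ((M / s + 1) ^ (k + 1) - 1) * U.card := by
          have : (1 : ℝ) ≤ (M / s + 1) ^ k := by linarith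
          gcongr

/-! ### Balanced separators and covers from tree decompositions -/

/-- Any two vertices of `C` are joined by a walk inside `C`. -/
def WalkConnected {V : Type u} (X : SimpleGraph V) (C : Set V) : Prop :=
  ∀ x ∈ C, ∀ y ∈ C, ∃ p : X.Walk x y, ∀ z ∈ p.support, z ∈ C

theorem TreeDecomposition.exists_mem_bag {V : Type u} {X : SimpleGraph V}
    (D : TreeDecomposition X) (v : V) : ∃ i, v ∈ D.bag i := by
  obtain ⟨⟨i, hi⟩⟩ := (D.connected_nodes v).nonempty
  exact ⟨i, hi⟩

/-- The nodes whose bags contain `v` are connected in the tree and do not include `i`, so no edge at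
`i` is needed to join them. -/
theorem TreeDecomposition.reachable_deleteEdges {V : Type u} {X : SimpleGraph V}
    (D : TreeDecomposition X) {i j : Fin D.size} {v : V} (hv : v ∉ D.bag i)
    {l l' : Fin D.size} (hl : v ∈ D.bag l) (hl' : v ∈ D.bag l') :
    (D.tree.deleteEdges {s(i, j)}).Reachable l l' := by
  have h := (D.connected_nodes v) ⟨l, hl⟩ ⟨l', hl'⟩
  let f : D.tree.induce {i | v ∈ D.bag i} →g D.tree.deleteEdges {s(i, j)} :=
    ⟨Subtype.val, fun {a b} hab => by
      rw [SimpleGraph.deleteEdges_adj]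
      refine ⟨hab, fun he => ?_⟩
      rw [Set.mem_singleton_iff, Sym2.eq_iff] at he
      rcases he with ⟨h1, -⟩ | ⟨-, h1⟩
      · exact hv (h1 ▸ a.2)
      · exact hv (h1 ▸ b.2)⟩
  exact h.map f

/-- A connected set that avoids the bag of `i` lies on one side of an edge at `i`. -/
theorem TreeDecomposition.exists_adj_forall_reachable {V : Type u} {X : SimpleGraph V}
    (D : TreeDecomposition X) {C : Set V} (hC : WalkConnected X C) (hne : C.Nonempty)
    {i : Fin D.size} (hi : ∀ v ∈ C, v ∉ D.bag i) :
    ∃ j, D.tree.Adj i j ∧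
      ∀ v ∈ C, ∀ l, v ∈ D.bag l → (D.tree.deleteEdges {s(i, j)}).Reachable j l := by
  obtain ⟨v₀, hv₀⟩ := hne
  obtain ⟨l₀, hl₀⟩ := D.exists_mem_bag v₀
  obtain ⟨p, hp⟩ := (D.isTree.connected i l₀).exists_isPath
  cases p with
  | nil => exact absurd hl₀ (hi v₀ hv₀)
  | @cons _ j _ hij q =>
    refine ⟨j, hij, ?_⟩
    have hiq : i ∉ q.support := ((SimpleGraph.Walk.cons_isPath_iff _ _).1 hp).2
    have h0 : (D.tree.deleteEdges {s(i, j)}).Reachable j l₀ := by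
      refine ⟨q.transfer _ fun e he => ?_⟩
      rw [SimpleGraph.edgeSet_deleteEdges]
      refine ⟨SimpleGraph.Walk.edges_subset_edgeSet q he, fun he' => ?_⟩
      rw [Set.mem_singleton_iff] at he'
      subst he'
      exact hiq (SimpleGraph.Walk.fst_mem_support_of_mem_edges q he)
    -- Adjacent vertices share a bag, so staying on the side of `j` propagates along walks inside
    -- `C`.
    have hwalk : ∀ {v w : V} (p : X.Walk v w), (∀ z ∈ p.support, z ∈ C) →
        (∀ l, v ∈ D.bag l → (D.tree.deleteEdges {s(i, j)}).Reachable j l) →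
        ∀ l, w ∈ D.bag l → (D.tree.deleteEdges {s(i, j)}).Reachable j l := by
      intro v w p
      induction p with
      | nil => exact fun _ h => h
      | @cons a b c hab r ih =>
        intro hsup ha
        refine ih (fun z hz => hsup z (by simp [hz])) fun l hl => ?_
        obtain ⟨m, ham, hbm⟩ := D.edge_in_bag a b hab
        exact (ha m ham).trans
          (D.reachable_deleteEdges (hi b (hsup b (by simp))) hbm hl)
    intro v hv
    obtain ⟨p, hp⟩ := hC v₀ hv₀ v hv
    exact hwalk p hp fun l hl => h0.trans (D.reachable_deleteEdges (hi v₀ hv₀) hl₀ hl)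

/-- Helly property: some bag meets all members of a family of pairwise intersecting connected
sets. -/
theorem TreeDecomposition.exists_bag_meets {V : Type u} {X : SimpleGraph V}
    (D : TreeDecomposition X) (H : Set (Set V)) (hconn : ∀ C ∈ H, WalkConnected X C)
    (hinter : ∀ C ∈ H, ∀ C' ∈ H, (C ∩ C').Nonempty) :
    ∃ i, ∀ C ∈ H, ∃ v ∈ C, v ∈ D.bag i := by
  classical
  by_contra! hcon
  choose C hCH hC using hcon
  have hf : ∀ i, ∃ j, D.tree.Adj i j ∧ ∀ v ∈ C i, ∀ l, v ∈ D.bag l →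
      (D.tree.deleteEdges {s(i, j)}).Reachable j l := fun i =>
    D.exists_adj_forall_reachable (hconn _ (hCH i))
      ((hinter _ (hCH i) _ (hCH i)).mono Set.inter_subset_left) (hC i)
  choose f hadj hf using hf
  -- If every bag missed some member, each node would select an incident edge towards the member it
  -- misses. A tree has fewer edges than nodes, so two nodes select the same edge from opposite
  -- ends; a common vertex of their two members would then lie on both sides of a bridge.
  have hcard : D.tree.edgeFinset.card < (Finset.univ : Finset (Fin D.size)).card := by
    have := D.isTree.card_edgeFinset
    rw [Finset.card_univ]
    omega
  obtain ⟨i, -, j, -, hij, he⟩ := Finset.exists_ne_map_eq_of_card_lt_of_maps_to hcard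
    (f := fun i => s(i, f i)) fun i _ => by simpa using hadj i
  rw [Sym2.eq_iff] at he
  rcases he with ⟨h, -⟩ | ⟨h1, h2⟩
  · exact hij h
  · obtain ⟨v, hvi, hvj⟩ := hinter _ (hCH i) _ (hCH j)
    obtain ⟨l, hl⟩ := D.exists_mem_bag v
    have r1 := hf i v hvi l hl
    have r2 := hf j v hvj l hl
    rw [← h1, Sym2.eq_swap] at r2
    rw [h2] at r1
    have hb := SimpleGraph.isAcyclic_iff_forall_adj_isBridge.1 D.isTree.isAcyclic (hadj i)
    rw [SimpleGraph.isBridge_iff, h2] at hb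
    exact hb (r2.trans r1.symm)

-- Two sets that each contain more than half of `U` intersect, so by the Helly property one bag
-- meets all such connected sets.
open Classical in
theorem TreeDecomposition.exists_balanced_separator {V : Type u} [Fintype V] {X : SimpleGraph V}
    (D : TreeDecomposition X) (U : Finset V) :
    ∃ S : Finset V, S.card ≤ D.width + 1 ∧ ∀ C : Set V, WalkConnected X C →
      (∀ v ∈ C, v ∉ S) → ∀ W ⊆ U, (W : Set V) ⊆ C → 2 * W.card ≤ U.card := by
  obtain ⟨i, hi⟩ := D.exists_bag_meets
    {C | WalkConnected X C ∧ U.card < 2 * {v ∈ U | v ∈ C}.card} (fun C hC => hC.1) (by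
      rintro C ⟨-, hC⟩ C' ⟨-, hC'⟩
      by_contra hne
      rw [Set.not_nonempty_iff_eq_empty] at hne
      have hdisj : Disjoint {v ∈ U | v ∈ C} {v ∈ U | v ∈ C'} := by
        rw [Finset.disjoint_left]
        intro v h1 h2
        have : v ∈ C ∩ C' := ⟨(Finset.mem_filter.1 h1).2, (Finset.mem_filter.1 h2).2⟩
        rw [hne] at this
        exact this
      have h1 := Finset.card_le_card (Finset.union_subset
        (Finset.filter_subset (· ∈ C) U) (Finset.filter_subset (· ∈ C') U))
      rw [Finset.card_union_of_disjoint hdisj] at h1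
      omega)
  refine ⟨D.bag i, ?_, fun C hC hS W hWU hWC => ?_⟩
  · have : (D.bag i).card ≤ Finset.univ.sup fun i => (D.bag i).card :=
      Finset.le_sup (f := fun i => (D.bag i).card) (Finset.mem_univ i)
    unfold TreeDecomposition.width
    omega
  · by_contra hlt
    have hW := Finset.card_le_card fun v hv => Finset.mem_filter.2 ⟨hWU hv, hWC hv⟩
    obtain ⟨v, hv, hvi⟩ := hi C ⟨hC, by omega⟩
    exact hS v hv hvi

/-- The graph `X` without the edges that meet `S`. -/
def avoiding {V : Type u} (X : SimpleGraph V) (S : Finset V) : SimpleGraph V where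
  Adj a b := X.Adj a b ∧ a ∉ S ∧ b ∉ S
  symm := ⟨fun _ _ h => ⟨h.1.symm, h.2.2, h.2.1⟩⟩
  loopless := ⟨fun _ h => X.loopless.irrefl _ h.1⟩

theorem avoiding_le {V : Type u} (X : SimpleGraph V) (S : Finset V) : avoiding X S ≤ X :=
  fun _ _ h => h.1

theorem reachable_avoiding {V : Type u} {X : SimpleGraph V} {S : Finset V} {a b : V}
    (p : X.Walk a b) (hp : ∀ z ∈ p.support, z ∉ S) : (avoiding X S).Reachable a b := by
  induction p with
  | nil => exact SimpleGraph.Reachable.refl _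
  | @cons a b c hab q ih =>
    have h1 : (avoiding X S).Adj a b := ⟨hab, hp a (by simp), hp b (by simp)⟩
    exact h1.reachable.trans (ih fun z hz => hp z (by simp [hz]))

theorem notMem_of_reachable_avoiding {V : Type u} {X : SimpleGraph V} {S : Finset V} {a b : V}
    (h : (avoiding X S).Reachable a b) (ha : a ∉ S) : b ∉ S := by
  obtain ⟨p⟩ := h
  induction p with
  | nil => exact ha
  | cons hab q ih => exact ih hab.2.2

theorem walkConnected_reachable_avoiding {V : Type u} (X : SimpleGraph V) (S : Finset V) (a : V) :
    WalkConnected X {b | (avoiding X S).Reachable a b} := by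
  classical
  intro x hx y hy
  obtain ⟨p⟩ := hx.symm.trans hy
  refine ⟨p.mapLe (avoiding_le X S), fun z hz => ?_⟩
  rw [SimpleGraph.Walk.support_mapLe_eq_support] at hz
  exact hx.trans (p.takeUntil z hz).reachable

theorem dist_add_dist_of_mem_support {V : Type u} {X : SimpleGraph V} {a b z : V}
    {p : X.Walk a b} (hp : p.length = X.dist a b) (hz : z ∈ p.support) :
    X.dist a z + X.dist z b ≤ X.dist a b := by
  classical
  have h1 : X.dist a z ≤ (p.takeUntil z hz).length := SimpleGraph.dist_le _
  have h2 : X.dist z b ≤ (p.dropUntil z hz).length := SimpleGraph.dist_le _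
  have h3 := congrArg SimpleGraph.Walk.length (p.take_spec hz)
  rw [SimpleGraph.Walk.length_append] at h3
  omega

/-- Two vertices that are separated by `S` are confirmed by a query of a neighbor of `S`. -/
theorem exists_confirmed_of_not_reachable {V : Type u} {X : SimpleGraph V}
    (hX : X.Connected) {S : Finset V} {x y s : V} (hs : s ∈ S) (hxS : x ∉ S)
    (hsep : ¬ (avoiding X S).Reachable x y)
    (hsx : ∀ t ∈ S, X.dist s x ≤ X.dist t x) (hsy : ∀ t ∈ S, X.dist s x ≤ X.dist t y)
    (hxy : x ≠ y) (hadj : ¬ X.Adj x y) :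
    ∃ b, X.Adj s b ∧ s(x, y) ∈ confirmed X b y := by
  have hd : X.dist s x ≠ 0 := fun h => hxS (hX.dist_eq_zero_iff.1 h ▸ hs)
  obtain ⟨d, hd⟩ := Nat.exists_eq_succ_of_ne_zero hd
  obtain ⟨b, hsb, hbx⟩ := exists_adj_dist_eq hd
  refine ⟨b, hsb, mem_confirmed_right hxy hadj ?_⟩
  have hbS : b ∉ S := fun h => by have := hsx b h; omega
  obtain ⟨p, hp⟩ := hX.exists_walk_length_eq_dist b x
  obtain ⟨q, hq⟩ := hX.exists_walk_length_eq_dist b y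
  have hpS : ∀ z ∈ p.support, z ∉ S := fun z hz hzS => by
    have h1 := dist_add_dist_of_mem_support hp hz
    have h2 := hsx z hzS
    omega
  -- A shortest path from `b` to `x` stays closer to `x` than `S` is, hence avoids `S`; a path from
  -- `b` to `y` must therefore cross `S`. At a crossing $t$, $\delta(b,y)\ge 1+\delta(t,y)\ge
  -- 1+\delta(s,x)=\delta(b,x)+2$.
  obtain ⟨t, htq, htS⟩ : ∃ t ∈ q.support, t ∈ S := by
    by_contra! hcon
    exact hsep ((reachable_avoiding p hpS).symm.trans (reachable_avoiding q hcon))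
  have h1 := dist_add_dist_of_mem_support hq htq
  have h2 := hsy t htS
  have h3 : 0 < X.dist b t := hX.pos_dist_of_ne fun h => hbS (h ▸ htS)
  omega

open Classical in
/-- The closed neighborhood of `S`. -/
noncomputable def closedNeighborhood {V : Type u} [Fintype V] (X : SimpleGraph V) (S : Finset V) :
    Finset V :=
  S.biUnion fun s => {b | s = b ∨ X.Adj s b}

theorem mem_closedNeighborhood {V : Type u} [Fintype V] {X : SimpleGraph V} {S : Finset V}
    {b : V} : b ∈ closedNeighborhood X S ↔ ∃ s ∈ S, s = b ∨ X.Adj s b := by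
  simp [closedNeighborhood]

open Classical in
theorem card_closedNeighborhood_le {V : Type u} [Fintype V] {X : SimpleGraph V} (S : Finset V)
    {D : ℕ} (hD : ∀ v, (Finset.univ.filter (X.Adj v)).card ≤ D) :
    (closedNeighborhood X S).card ≤ S.card * (D + 1) := by
  refine Finset.card_biUnion_le_card_mul _ _ _ fun s _ => ?_
  rw [Finset.filter_or]
  refine (Finset.card_union_le _ _).trans ?_
  refine (add_le_add (Finset.card_le_one.2 fun a ha b hb => ?_) (hD s)).trans (add_comm 1 D).le
  exact (Finset.mem_filter.1 ha).2.symm.trans (Finset.mem_filter.1 hb).2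

/-- A pair meeting `S` is confirmed by querying the pair itself, a separated pair from a neighbor of
`S`, and a pair in one component by the recursive covers. -/
theorem isCover_separator_step {V : Type u} [Fintype V] [DecidableEq V] {X : SimpleGraph V}
    (hX : X.Connected) {U S : Finset V} (I : Finset (Finset V)) (T : Finset V → Finset (V × V))
    (hI : ∀ x ∈ U, ∀ y ∈ U, x ∉ S → y ∉ S → (avoiding X S).Reachable x y →
      ∃ W ∈ I, x ∈ W ∧ y ∈ W)
    (hT : ∀ W ∈ I, IsCover X W (T W)) :
    IsCover X U (closedNeighborhood X S ×ˢ U ∪ I.biUnion T) := by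
  have hSN : ∀ x ∈ S, x ∈ closedNeighborhood X S := fun x hx =>
    mem_closedNeighborhood.2 ⟨x, hx, Or.inl rfl⟩
  have key : ∀ x ∈ U, ∀ y ∈ U, x ≠ y → ¬ X.Adj x y → x ∉ S →
      ¬ (avoiding X S).Reachable x y → ∀ s ∈ S,
      (∀ t ∈ S, X.dist s x ≤ X.dist t x) → (∀ t ∈ S, X.dist s x ≤ X.dist t y) →
      ∃ p ∈ closedNeighborhood X S ×ˢ U ∪ I.biUnion T, s(x, y) ∈ confirmed X p.1 p.2 := by
    intro x _ y hy hxy hadj hxS hsep s hs hsx hsy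
    obtain ⟨b, hsb, hb⟩ := exists_confirmed_of_not_reachable hX hs hxS hsep hsx hsy hxy hadj
    exact ⟨(b, y), Finset.mem_union_left _ (Finset.mk_mem_product
      (mem_closedNeighborhood.2 ⟨s, hs, Or.inr hsb⟩) hy), hb⟩
  intro x hx y hy hxy hadj
  by_cases hxS : x ∈ S
  · exact ⟨(x, y), Finset.mem_union_left _ (Finset.mk_mem_product (hSN x hxS) hy),
      mem_confirmed_self hX hxy hadj⟩
  by_cases hyS : y ∈ S
  · refine ⟨(y, x), Finset.mem_union_left _ (Finset.mk_mem_product (hSN y hyS) hx), ?_⟩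
    rw [Sym2.eq_swap]
    exact mem_confirmed_self hX hxy.symm fun h => hadj h.symm
  by_cases hsep : (avoiding X S).Reachable x y
  · obtain ⟨W, hW, hxW, hyW⟩ := hI x hx y hy hxS hyS hsep
    obtain ⟨p, hp, hpc⟩ := hT W hW x hxW y hyW hxy hadj
    exact ⟨p, Finset.mem_union_right _ (Finset.mem_biUnion.2 ⟨W, hW, hp⟩), hpc⟩
  · have hSne : S.Nonempty := by
      obtain ⟨p⟩ := hX x y
      by_contra hne
      rw [Finset.not_nonempty_iff_eq_empty] at hne
      exact hsep (reachable_avoiding p (by simp [hne]))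
    obtain ⟨s, hs, hsx⟩ := S.exists_min_image (fun a => X.dist a x) hSne
    obtain ⟨t, ht, hty⟩ := S.exists_min_image (fun a => X.dist a y) hSne
    rcases le_total (X.dist s x) (X.dist t y) with h | h
    · exact key x hx y hy hxy hadj hxS hsep s hs hsx fun a ha => h.trans (hty a ha)
    · rw [Sym2.eq_swap]
      exact key y hy x hx hxy.symm (fun h' => hadj h'.symm) hyS (fun h' => hsep h'.symm) t ht hty
        fun a ha => h.trans (hsx a ha)

-- One level costs at most $(w+1)(d+1)|U|$, where $w$ is the width. The parts are disjoint and at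
-- most half as large as $U$, so the next level costs no more in total and $\log_2|U|$ falls by at
-- least one.
open Classical in
theorem TreeDecomposition.exists_isCover {V : Type u} [Fintype V] {X : SimpleGraph V}
    (D : TreeDecomposition X) (hX : X.Connected) {d : ℕ}
    (hd : ∀ v, (Finset.univ.filter (X.Adj v)).card ≤ d) (m : ℕ) :
    ∀ U : Finset V, U.card = m → ∃ T : Finset (V × V), IsCover X U T ∧
      (T.card : ℝ) ≤ (D.width + 1) * (d + 1) * U.card * (Real.log U.card / Real.log 2) := by
  have hlog2 : 0 < Real.log 2 := Real.log_pos one_lt_two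
  induction m using Nat.strong_induction_on with
  | _ m ih =>
    intro U hU
    rcases Nat.lt_or_ge 1 U.card with h1 | h1
    · obtain ⟨S, hScard, hS⟩ := D.exists_balanced_separator U
      set Y := avoiding X S with hY
      set part : Y.ConnectedComponent → Finset V :=
        fun c => {v ∈ U \ S | Y.connectedComponentMk v = c} with hpart
      set J : Finset Y.ConnectedComponent := (U \ S).image Y.connectedComponentMk with hJ
      have hhalf : ∀ c ∈ J, 2 * (part c).card ≤ U.card ∧ 0 < (part c).card := by
        intro c hc
        obtain ⟨a, ha, rfl⟩ := Finset.mem_image.1 hc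
        refine ⟨?_, Finset.card_pos.2 ⟨a, Finset.mem_filter.2 ⟨ha, rfl⟩⟩⟩
        refine hS {b | Y.Reachable a b} (walkConnected_reachable_avoiding X S a)
          (fun v hv => notMem_of_reachable_avoiding hv (Finset.mem_sdiff.1 ha).2) _
          ((Finset.filter_subset _ _).trans Finset.sdiff_subset) fun v hv => ?_
        exact (SimpleGraph.ConnectedComponent.exact (Finset.mem_filter.1 hv).2).symm
      have hsum : ∑ c ∈ J, (part c).card ≤ U.card := by
        rw [← Finset.card_eq_sum_card_image]
        exact Finset.card_le_card Finset.sdiff_subset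
      have hTex : ∀ W : Finset V, ∃ T : Finset (V × V), W.card < U.card → IsCover X W T ∧
          (T.card : ℝ) ≤ (D.width + 1) * (d + 1) * W.card *
            (Real.log W.card / Real.log 2) := fun W => by
        by_cases hW : W.card < U.card
        · obtain ⟨T, hT⟩ := ih _ (hU ▸ hW) W rfl
          exact ⟨T, fun _ => hT⟩
        · exact ⟨∅, fun h => absurd h hW⟩
      choose T hT using hTex
      have hlt : ∀ c ∈ J, (part c).card < U.card := fun c hc => by
        have := hhalf c hc
        omega
      refine ⟨closedNeighborhood X S ×ˢ U ∪ (J.image part).biUnion T,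
        isCover_separator_step hX (J.image part) T (fun x hx y hy hxS hyS hxy => ?_)
          (fun W hW => ?_), ?_⟩
      · refine ⟨part (Y.connectedComponentMk x), Finset.mem_image_of_mem _
          (Finset.mem_image_of_mem _ (Finset.mem_sdiff.2 ⟨hx, hxS⟩)), ?_, ?_⟩
        · exact Finset.mem_filter.2 ⟨Finset.mem_sdiff.2 ⟨hx, hxS⟩, rfl⟩
        · exact Finset.mem_filter.2 ⟨Finset.mem_sdiff.2 ⟨hy, hyS⟩,
            SimpleGraph.ConnectedComponent.sound hxy.symm⟩
      · obtain ⟨c, hc, rfl⟩ := Finset.mem_image.1 hW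
        exact (hT _ (hlt c hc)).1
      · set K : ℝ := (D.width + 1) * (d + 1) with hK
        have hK0 : 0 ≤ K := by positivity
        have hUr : (0 : ℝ) < U.card := by exact_mod_cast (by omega : 0 < U.card)
        -- Nonnegativity allows the sum of the part sizes to be replaced by $|U|$.
        have hlevel : 0 ≤ Real.log U.card / Real.log 2 - 1 := by
          rw [sub_nonneg, le_div_iff₀ hlog2, one_mul]
          exact Real.log_le_log two_pos (by exact_mod_cast h1)
        have hTc : ∀ c ∈ J, ((T (part c)).card : ℝ) ≤
            (part c).card * (K * (Real.log U.card / Real.log 2 - 1)) := by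
          intro c hc
          obtain ⟨h2, h0⟩ := hhalf c hc
          have h0r : (0 : ℝ) < (part c).card := by exact_mod_cast h0
          have hl : Real.log (part c).card / Real.log 2 ≤ Real.log U.card / Real.log 2 - 1 := by
            rw [div_sub_one hlog2.ne']
            gcongr
            rw [le_sub_iff_add_le, ← Real.log_mul h0r.ne' two_ne_zero]
            apply Real.log_le_log (by positivity)
            rw [mul_comm]
            exact_mod_cast h2
          calc ((T (part c)).card : ℝ)
              ≤ K * (part c).card * (Real.log (part c).card / Real.log 2) :=
                (hT _ (hlt c hc)).2
            _ ≤ K * (part c).card * (Real.log U.card / Real.log 2 - 1) := by gcongr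
            _ = _ := by ring
        have hTs : (((J.image part).biUnion T).card : ℝ) ≤
            U.card * (K * (Real.log U.card / Real.log 2 - 1)) := by
          rw [Finset.image_biUnion]
          calc ((J.biUnion fun c => T (part c)).card : ℝ) ≤ ∑ c ∈ J, ((T (part c)).card : ℝ) := by
                exact_mod_cast Finset.card_biUnion_le
            _ ≤ ∑ c ∈ J, (part c).card * (K * (Real.log U.card / Real.log 2 - 1)) :=
                Finset.sum_le_sum hTc
            _ = (∑ c ∈ J, (part c).card : ℕ) * (K * (Real.log U.card / Real.log 2 - 1)) := by
                push_cast
                rw [Finset.sum_mul]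
            _ ≤ _ := by gcongr
        have hN : ((closedNeighborhood X S).card : ℝ) ≤ K := by
          have := (card_closedNeighborhood_le S hd).trans (Nat.mul_le_mul_right _ hScard)
          rw [hK]
          exact_mod_cast this
        calc ((closedNeighborhood X S ×ˢ U ∪ (J.image part).biUnion T).card : ℝ)
            ≤ (closedNeighborhood X S ×ˢ U).card + ((J.image part).biUnion T).card := by
              exact_mod_cast Finset.card_union_le _ _
          _ ≤ K * U.card + U.card * (K * (Real.log U.card / Real.log 2 - 1)) := by
              rw [Finset.card_product]
              push_cast
              gcongr
          _ = K * U.card * (Real.log U.card / Real.log 2) := by ring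
    · refine ⟨∅, fun a ha b hb hab => absurd (Finset.card_le_one.1 h1 a ha b hb) hab, ?_⟩
      have := Real.log_natCast_nonneg U.card
      rw [Finset.card_empty]
      push_cast
      positivity

/-! ### Inherited parameters and small cases -/

/-- A tree decomposition of a graph is one of every subgraph. -/
def TreeDecomposition.ofLE {V : Type u} {G X : SimpleGraph V} (D : TreeDecomposition G)
    (h : X ≤ G) : TreeDecomposition X :=
  { D with edge_in_bag := fun u v huv => D.edge_in_bag u v (h huv) }

theorem exists_treeDecomposition_width_eq {V : Type u} [Fintype V] (G : SimpleGraph V) :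
    ∃ D : TreeDecomposition G, D.width = treewidth G := by
  -- The one-bag decomposition: the infimum of a nonempty set of naturals is attained.
  have hne : {k | ∃ D : TreeDecomposition G, D.width = k}.Nonempty :=
    ⟨_, { size := 1
          tree := ⊥
          isTree := SimpleGraph.IsTree.of_subsingleton
          bag := fun _ => Finset.univ
          connected_nodes := fun v => by
            have : Nonempty {i : Fin 1 | v ∈ (Finset.univ : Finset V)} := ⟨0, by simp⟩
            exact SimpleGraph.IsTree.of_subsingleton.connected
          edge_in_bag := fun u v _ => ⟨0, by simp⟩ }, rfl⟩
  exact Nat.sInf_mem hne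

theorem one_le_treewidth {V : Type u} [Fintype V] {G : SimpleGraph V} {a b : V}
    (h : G.Adj a b) : 1 ≤ treewidth G := by
  classical
  obtain ⟨D, hD⟩ := exists_treeDecomposition_width_eq G
  obtain ⟨i, ha, hb⟩ := D.edge_in_bag a b h
  have h1 : 1 < (D.bag i).card := Finset.one_lt_card.2 ⟨a, ha, b, hb, h.ne⟩
  have h2 : (D.bag i).card ≤ Finset.univ.sup fun i => (D.bag i).card :=
    Finset.le_sup (f := fun i => (D.bag i).card) (Finset.mem_univ i)
  rw [← hD, TreeDecomposition.width]
  omega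

theorem QueryAlgorithm.ReconstructsWithin.mono {V : Type u} {A : QueryAlgorithm V}
    {G : SimpleGraph V} {b c : ℝ} (h : A.ReconstructsWithin G b) (hbc : b ≤ c) :
    A.ReconstructsWithin G c := fun O =>
  let ⟨q, hq, hqb⟩ := h O
  ⟨q, hq, hqb.trans hbc⟩

open Classical in
theorem card_filter_adj_le_maxDegree {V : Type u} [Fintype V] {G X : SimpleGraph V}
    [DecidableRel G.Adj] (h : X ≤ G) (v : V) :
    (Finset.univ.filter (X.Adj v)).card ≤ G.maxDegree := by
  refine le_trans (Finset.card_le_card fun w hw => ?_) (G.degree_le_maxDegree v)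
  rw [SimpleGraph.mem_neighborFinset]
  exact h (Finset.mem_filter.1 hw).2

theorem exists_adj_of_two_le_card {V : Type u} [Fintype V] {G : SimpleGraph V}
    (hG : G.Connected) (h : 2 ≤ Fintype.card V) : ∃ a b, G.Adj a b := by
  obtain ⟨a, b, hab⟩ := Fintype.exists_pair_of_one_lt_card h
  obtain ⟨d, hd⟩ := Nat.exists_eq_succ_of_ne_zero (hG.pos_dist_of_ne hab).ne'
  obtain ⟨c, hc, -⟩ := exists_adj_dist_eq hd
  exact ⟨a, c, hc⟩

theorem one_le_maxDegree {V : Type u} [Fintype V] {G : SimpleGraph V} [DecidableRel G.Adj]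
    (hG : G.Connected) (h : 2 ≤ Fintype.card V) : 1 ≤ G.maxDegree := by
  obtain ⟨a, b, hab⟩ := exists_adj_of_two_le_card hG h
  refine le_trans ?_ (G.degree_le_maxDegree a)
  exact Finset.card_pos.2 ⟨b, by simpa using hab⟩

/-- The treewidth bound is zero for $n=1$ because $\log 1=0$, so no query at all is allowed there.
-/
theorem reconstructsWithin_zero_of_card_eq_one {V : Type u} [Fintype V] (r : GreedyRule V)
    {G : SimpleGraph V} [DecidableRel G.Adj] (h : Fintype.card V = 1) :
    (greedy r).ReconstructsWithin G 0 := by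
  have hsub : Subsingleton V := (Fintype.card_le_one_iff_subsingleton.1 h.le)
  refine (reconstructsWithin_of_cover r le_rfl fun X _ _ =>
    ⟨∅, fun a _ b _ hab => absurd (Subsingleton.elim a b) hab, by simp⟩).mono ?_
  simp [h, decayBound_zero]

theorem reconstructsWithin_of_cover_of_two_le {V : Type u} [Fintype V] (r : GreedyRule V)
    {G : SimpleGraph V} [DecidableRel G.Adj] (h : 2 ≤ Fintype.card V) {N : ℝ} (hN0 : 0 ≤ N)
    (hN : ∀ X : SimpleGraph V, X.Connected → X ≤ G →
      ∃ T : Finset (V × V), IsCover X Finset.univ T ∧ (T.card : ℝ) ≤ N) :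
    (greedy r).ReconstructsWithin G ((Fintype.card V : ℝ) + Fintype.card V * G.maxDegree +
      2 * N * Real.log (Fintype.card V)) := by
  refine (reconstructsWithin_of_cover r hN0 hN).mono ?_
  have h1 : decayBound N (Fintype.card V * (Fintype.card V - 1)) ≤
      decayBound N (Fintype.card V * Fintype.card V) :=
    decayBound_mono hN0 (Nat.mul_le_mul_left _ (Nat.sub_le _ _))
  rw [decayBound_of_pos N (by positivity : 0 < Fintype.card V * Fintype.card V)] at h1
  push_cast at h1
  have h0 : (Fintype.card V : ℝ) ≠ 0 := by
    have : Fintype.card V ≠ 0 := by omega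
    exact_mod_cast this
  rw [Real.log_mul h0 h0] at h1
  linarith

theorem one_lt_log_natCast {n : ℕ} (hn : 3 ≤ n) : 1 < Real.log n := by
  rw [Real.lt_log_iff_exp_lt (by positivity)]
  have h1 := Real.exp_one_lt_d9
  have h2 : (3 : ℝ) ≤ n := by exact_mod_cast hn
  linarith

/-! ### The general bound -/

/-- For every number `k` of levels of the recursion, a bound on the number of queries. -/
theorem reconstructsWithin_levels {V : Type u} [Fintype V] (r : GreedyRule V)
    {G : SimpleGraph V} [DecidableRel G.Adj] (hG : G.Connected) (h : 3 ≤ Fintype.card V)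
    {k : ℕ} (hk : k ≠ 0) :
    (greedy r).ReconstructsWithin G (5 * (G.maxDegree * Real.log (Fintype.card V)) *
      (Fintype.card V * (Fintype.card V : ℝ) ^ (1 / k : ℝ) *
        (20 * G.maxDegree ^ 2 * Real.log (Fintype.card V)) ^ k)) := by
  set n : ℝ := (Fintype.card V : ℝ) with hn
  set D : ℝ := (G.maxDegree : ℝ) with hD
  set l := Real.log n with hl
  have hn3 : (3 : ℝ) ≤ n := by rw [hn]; exact_mod_cast h
  have hl1 : 1 < l := one_lt_log_natCast h
  have hD1 : 1 ≤ D := by rw [hD]; exact_mod_cast one_le_maxDegree hG (by omega)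
  set s : ℝ := n ^ (1 / k : ℝ) with hs
  have hs1 : 1 ≤ s := Real.one_le_rpow (by linarith) (by positivity)
  have hsk : s ^ k = n := by
    rw [hs, ← Real.rpow_natCast, ← Real.rpow_mul (by linarith), one_div,
      inv_mul_cancel₀ (by exact_mod_cast hk), Real.rpow_one]
  set Q : ℝ := 20 * D ^ 2 * l with hQ
  have hDD : 1 ≤ D ^ 2 := one_le_pow₀ hD1
  have hQ1 : 1 ≤ Q := by nlinarith
  have hQk : 1 ≤ Q ^ k := one_le_pow₀ hQ1
  have hN1 : n ≤ n * s * Q ^ k := by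
    calc n = n * 1 * 1 := by ring
      _ ≤ n * s * Q ^ k := by gcongr
  refine (reconstructsWithin_of_cover_of_two_le r (by omega)
    (by linarith : 0 ≤ n * s * Q ^ k) fun X hX hXG => ?_).mono ?_
  · obtain ⟨T, hT, hTc⟩ := exists_isCover_of_card_le_pow hX
      (card_filter_adj_le_maxDegree hXG) (by linarith : 0 < s) le_rfl k Finset.univ
      (by rw [hsk, Finset.card_univ])
    refine ⟨T, hT, hTc.trans ?_⟩
    rw [Finset.card_univ, ← hn, ← hD, ← hl]
    -- The quotient is at most $3D^2\cdot 6l=18D^2l$; the constant 20 absorbs the added 1.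
    have hMs : (1 + D + D ^ 2) * (2 + 4 * s * l) / s + 1 ≤ Q := by
      have h1 : (1 + D + D ^ 2) * (2 + 4 * s * l) / s ≤ (3 * D ^ 2) * (6 * l) := by
        rw [div_le_iff₀ (by linarith)]
        have h2 : 1 + D + D ^ 2 ≤ 3 * D ^ 2 := by nlinarith
        have h3 : 2 + 4 * s * l ≤ 6 * l * s := by nlinarith
        calc (1 + D + D ^ 2) * (2 + 4 * s * l) ≤ (3 * D ^ 2) * (6 * l * s) := by gcongr
          _ = _ := by ring
      nlinarith
    calc s * (((1 + D + D ^ 2) * (2 + 4 * s * l) / s + 1) ^ k - 1) * n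
        ≤ s * Q ^ k * n := by
          have : ((1 + D + D ^ 2) * (2 + 4 * s * l) / s + 1) ^ k ≤ Q ^ k := by gcongr
          gcongr
          linarith
      _ = n * s * Q ^ k := by ring
  · rw [← hn, ← hD, ← hl]
    set N := n * s * Q ^ k with hN
    have hDl : 1 ≤ D * l := by nlinarith
    have hN0 : 0 ≤ N := by linarith
    have h1 : n ≤ N * (D * l) := by nlinarith
    have h2 : n * D ≤ N * (D * l) := by
      calc n * D ≤ N * D := by gcongr
        _ ≤ N * (D * l) := by
          gcongr
          nlinarith
    have h3 : N * l ≤ N * (D * l) := by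
      gcongr
      nlinarith
    linarith

/-- The choice of the number of levels. -/
theorem exists_levels_le_rpow {c₀ : ℝ} (hc₀ : 0 < c₀) : ∃ C : ℝ, 0 < C ∧ ∀ n D : ℝ, 1 < n →
    1 < Real.log n → 1 ≤ D → D ≤ n → c₀ ≤ Real.log (Real.log n) → ∃ k : ℕ, k ≠ 0 ∧
      5 * (D * Real.log n) * (n * n ^ (1 / k : ℝ) * (20 * D ^ 2 * Real.log n) ^ k) ≤
        n ^ (1 + C * Real.sqrt ((Real.log (Real.log n) + Real.log D) / Real.log n)) := by
  -- Chosen so that $20D^2l\le e^{aL}$: the first term absorbs 20, using $L\ge c_0$, and the 2 comes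
  -- from $(Dl)^2=e^{2L}$.
  set a : ℝ := Real.log 20 / c₀ + 2 with ha
  have hlog20 : 0 < Real.log 20 := Real.log_pos (by norm_num)
  have ha0 : 0 < a := by positivity
  refine ⟨1 + 6 * a, by positivity, fun n D hn hl hD hDn hc => ?_⟩
  set l := Real.log n with hldef
  set L := Real.log l + Real.log D with hL
  set w := Real.sqrt (l / L) with hw
  set ρ := Real.sqrt (L / l) with hρ
  have hl0 : 0 < l := by linarith
  have hD0 : 0 < D := by linarith
  have hn0 : 0 < n := by linarith
  have hlogD : 0 ≤ Real.log D := Real.log_nonneg hD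
  have hLc : c₀ ≤ L := by linarith
  have hL0 : 0 < L := by linarith
  have hL2 : L ≤ 2 * l := by
    have h1 : Real.log l ≤ l := Real.log_le_self hl0.le
    have h2 : Real.log D ≤ l := Real.log_le_log hD0 hDn
    linarith
  have hρ0 : 0 < ρ := Real.sqrt_pos.2 (by positivity)
  have hw0 : 0 < w := Real.sqrt_pos.2 (by positivity)
  have hwρ : w * ρ = 1 := by
    rw [hw, hρ, ← Real.sqrt_mul (by positivity)]
    have : l / L * (L / l) = 1 := by field_simp
    rw [this, Real.sqrt_one]
  have hρ2 : ρ ^ 2 * l = L := by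
    rw [hρ, Real.sq_sqrt (by positivity)]
    field_simp
  have hw1 : 1 ≤ 2 * w := by
    have h1 : (1 / 2 : ℝ) ≤ w := by
      rw [hw]
      apply Real.le_sqrt_of_sq_le
      rw [le_div_iff₀ hL0]
      linarith
    linarith
  have hwL : w * L = ρ * l := by
    calc w * L = (w * ρ) * (ρ * l) := by rw [← hρ2]; ring
      _ = ρ * l := by rw [hwρ, one_mul]
  -- With $k\approx w=\sqrt{l/L}$, both $n^{1/k}\approx e^{l/k}$ and $e^{akL}$ are
  -- $e^{O(\sqrt{lL})}$, and $\sqrt{lL}=\rho l$.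
  refine ⟨⌈w⌉₊, (Nat.ceil_pos.2 hw0).ne', ?_⟩
  set k := ⌈w⌉₊ with hk
  have hk1 : w ≤ k := Nat.le_ceil w
  have hk2 : (k : ℝ) ≤ 3 * w := by
    have := Nat.ceil_lt_add_one hw0.le
    linarith
  have hk3 : (1 : ℝ) ≤ k := by
    exact_mod_cast Nat.ceil_pos.2 hw0
  have hDl : D * l = Real.exp L := by
    rw [hL, Real.exp_add, Real.exp_log hl0, Real.exp_log hD0, mul_comm]
  have h20 : (20 : ℝ) ≤ Real.exp (Real.log 20 / c₀ * L) := by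
    rw [← Real.log_le_iff_le_exp (by norm_num)]
    calc Real.log 20 = Real.log 20 / c₀ * c₀ := by field_simp
      _ ≤ _ := by gcongr
  have hbase : 20 * D ^ 2 * l ≤ Real.exp (a * L) := by
    calc 20 * D ^ 2 * l ≤ 20 * (D * l) ^ 2 := by
          have : D ^ 2 * 1 * l ≤ D ^ 2 * l * l := by gcongr
          nlinarith
      _ ≤ Real.exp (Real.log 20 / c₀ * L) * Real.exp L ^ 2 := by
          rw [hDl]; gcongr
      _ = Real.exp (a * L) := by
          rw [← Real.exp_nat_mul, ← Real.exp_add, ha]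
          congr 1
          push_cast
          ring
  have hfirst : 5 * (D * l) ≤ Real.exp (a * L) := by
    refine le_trans ?_ hbase
    have : D * l * 1 ≤ D * l * D := by gcongr
    nlinarith
  have hroot : n ^ (1 / k : ℝ) ≤ Real.exp (ρ * l) := by
    rw [Real.rpow_def_of_pos hn0, ← hldef]
    apply Real.exp_le_exp.2
    have h1 : (1 / k : ℝ) ≤ ρ := by
      rw [div_le_iff₀ (by linarith)]
      calc 1 = ρ * w := by rw [mul_comm, hwρ]
        _ ≤ ρ * k := by gcongr
    rw [mul_comm]
    gcongr
  calc 5 * (D * l) * (n * n ^ (1 / k : ℝ) * (20 * D ^ 2 * l) ^ k)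
      ≤ Real.exp (a * L) * (Real.exp l * Real.exp (ρ * l) * Real.exp (a * L) ^ k) := by
        rw [hldef, Real.exp_log hn0, ← hldef]
        gcongr
    _ = Real.exp (l + ρ * l + (k + 1) * (a * L)) := by
        rw [← Real.exp_nat_mul, ← Real.exp_add, ← Real.exp_add, ← Real.exp_add]
        congr 1
        ring
    -- Here $k+1\le 2k\le 6w$.
    _ ≤ Real.exp (l + ρ * l + (6 * w) * (a * L)) := by
        apply Real.exp_le_exp.2
        gcongr
        linarith
    _ = n ^ (1 + (1 + 6 * a) * ρ) := by
        rw [Real.rpow_def_of_pos hn0, ← hldef]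
        congr 1
        linear_combination 6 * a * hwL

/-- The constant $c_0$ is $\log\log 3>0$, which is where $n\ge 3$ enters. -/
theorem exists_general_bound : ∃ C : ℝ, 0 < C ∧
    ∀ (V : Type u) [Fintype V] (r : GreedyRule V) (G : SimpleGraph V) [DecidableRel G.Adj],
      G.Connected → 3 ≤ Fintype.card V → (greedy r).ReconstructsWithin G
        ((Fintype.card V : ℝ) ^ (1 + C * Real.sqrt
          ((Real.log (Real.log (Fintype.card V : ℝ)) + Real.log (G.maxDegree : ℝ)) /
            Real.log (Fintype.card V : ℝ)))) := by
  have hlog3 : 1 < Real.log (3 : ℕ) := one_lt_log_natCast le_rfl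
  obtain ⟨C, hC, h⟩ := exists_levels_le_rpow (Real.log_pos hlog3)
  refine ⟨C, hC, fun V _ r G _ hG hV => ?_⟩
  have hn : (3 : ℝ) ≤ Fintype.card V := by exact_mod_cast hV
  obtain ⟨k, hk, hle⟩ := h (Fintype.card V) G.maxDegree (by linarith) (one_lt_log_natCast hV)
    (by exact_mod_cast one_le_maxDegree hG (by omega))
    (by
      have : Nonempty V := hG.nonempty
      exact_mod_cast G.maxDegree_lt_card_verts.le)
    (Real.log_le_log (by linarith) (Real.log_le_log (by norm_num) (by exact_mod_cast hV)))
  exact (reconstructsWithin_levels r hG hV hk).mono hle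

theorem reconstructsWithin_of_card_eq_two {V : Type u} [Fintype V] (r : GreedyRule V)
    {G : SimpleGraph V} [DecidableRel G.Adj] (h : Fintype.card V = 2) :
    (greedy r).ReconstructsWithin G 16 := by
  have : Nonempty V := ⟨r.root⟩
  have hD : (G.maxDegree : ℝ) ≤ 1 := by
    have := G.maxDegree_lt_card_verts
    exact_mod_cast (by omega : G.maxDegree ≤ 1)
  refine (reconstructsWithin_of_cover_of_two_le r h.ge (N := 4) (by norm_num) fun X hX _ =>
    ⟨Finset.univ, fun a _ b _ hab hadj =>
      ⟨(a, b), Finset.mem_univ _, mem_confirmed_self hX hab hadj⟩, ?_⟩).mono ?_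
  · rw [Finset.card_univ, Fintype.card_prod, h]
    norm_num
  · rw [h]
    have := Real.log_two_lt_d9
    push_cast
    linarith

theorem tendsto_sqrt_log_log_div_log_add {ε : ℕ → ℝ}
    (hε : Filter.Tendsto ε Filter.atTop (nhds 0)) (C : ℝ) :
    Filter.Tendsto (fun n : ℕ => C * Real.sqrt (Real.log (Real.log n) / Real.log n + |ε n|))
      Filter.atTop (nhds 0) := by
  have h1 : Filter.Tendsto (fun x : ℝ => Real.log x / x) Filter.atTop (nhds 0) :=
    Real.isLittleO_log_id_atTop.tendsto_div_nhds_zero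
  have h2 : Filter.Tendsto (fun n : ℕ => Real.log (Real.log n) / Real.log n)
      Filter.atTop (nhds 0) :=
    h1.comp (Real.tendsto_log_atTop.comp tendsto_natCast_atTop_atTop)
  have h3 := ((h2.add hε.abs).sqrt).const_mul C
  simpa using h3

theorem exists_exponent_tendsto (ε : ℕ → ℝ) (hε : Filter.Tendsto ε Filter.atTop (nhds 0)) :
    ∃ η : ℕ → ℝ, Filter.Tendsto η Filter.atTop (nhds 0) ∧
      ∀ (V : Type u) [Fintype V] (r : GreedyRule V) (G : SimpleGraph V) [DecidableRel G.Adj],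
        G.Connected → (G.maxDegree : ℝ) ≤ (Fintype.card V : ℝ) ^ ε (Fintype.card V) →
        (greedy r).ReconstructsWithin G
          ((Fintype.card V : ℝ) ^ (1 + η (Fintype.card V))) := by
  obtain ⟨C, hC, h⟩ := exists_general_bound.{u}
  -- The value 3 serves $n=2$, where $2^{1+3}=16$ is the bound of
  -- `reconstructsWithin_of_card_eq_two`.
  refine ⟨fun n => if n < 3 then 3 else
    C * Real.sqrt (Real.log (Real.log n) / Real.log n + |ε n|), ?_, ?_⟩
  · refine (tendsto_sqrt_log_log_div_log_add hε C).congr' ?_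
    filter_upwards [Filter.eventually_ge_atTop 3] with n hn
    rw [if_neg (by omega)]
  · intro V _ r G _ hG hdeg
    beta_reduce
    have hpos : 0 < Fintype.card V := Fintype.card_pos_iff.2 hG.nonempty
    rcases Nat.lt_or_ge (Fintype.card V) 3 with hlt | hge
    · rw [if_pos hlt]
      obtain h1 | h2 : Fintype.card V = 1 ∨ Fintype.card V = 2 := by omega
      · exact (reconstructsWithin_zero_of_card_eq_one r h1).mono (by positivity)
      · refine (reconstructsWithin_of_card_eq_two r h2).mono ?_
        rw [h2]
        norm_num
    · rw [if_neg (by omega)]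
      refine (h V r G hG hge).mono ?_
      have hn : (1 : ℝ) ≤ Fintype.card V := by exact_mod_cast hpos
      have hl := one_lt_log_natCast hge
      have hD : (0 : ℝ) < G.maxDegree := by
        exact_mod_cast one_le_maxDegree hG (by omega)
      have hlogD : Real.log G.maxDegree ≤
          |ε (Fintype.card V)| * Real.log (Fintype.card V) := by
        calc Real.log G.maxDegree ≤ Real.log ((Fintype.card V : ℝ) ^ ε (Fintype.card V)) :=
              Real.log_le_log hD hdeg
          _ = ε (Fintype.card V) * Real.log (Fintype.card V) :=
              Real.log_rpow (by linarith) _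
          _ ≤ _ := by
            gcongr
            exact le_abs_self _
      refine Real.rpow_le_rpow_of_exponent_le hn ?_
      gcongr
      rw [add_div]
      gcongr
      rwa [div_le_iff₀ (by linarith)]

/-! ### The treewidth bound -/

theorem exists_treewidth_bound : ∃ C : ℝ, 0 < C ∧
    ∀ (V : Type u) [Fintype V] (r : GreedyRule V) (G : SimpleGraph V) [DecidableRel G.Adj],
      G.Connected → (greedy r).ReconstructsWithin G
        (C * ((G.maxDegree : ℝ) * ((G.maxDegree : ℝ) +
            (treewidth G : ℝ) * Real.log (Fintype.card V : ℝ)) *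
          (Fintype.card V : ℝ) * Real.log (Fintype.card V : ℝ) ^ 2)) := by
  refine ⟨32, by norm_num, fun V _ r G _ hG => ?_⟩
  have hpos : 0 < Fintype.card V := Fintype.card_pos_iff.2 hG.nonempty
  obtain h1 | h2 : Fintype.card V = 1 ∨ 2 ≤ Fintype.card V := by omega
  · refine (reconstructsWithin_zero_of_card_eq_one r h1).mono ?_
    simp [h1]
  · obtain ⟨E, hE⟩ := exists_treeDecomposition_width_eq G
    obtain ⟨a, b, hab⟩ := exists_adj_of_two_le_card hG h2
    have ht : (1 : ℝ) ≤ treewidth G := by exact_mod_cast one_le_treewidth hab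
    have hD : (1 : ℝ) ≤ G.maxDegree := by exact_mod_cast one_le_maxDegree hG h2
    have hn : (2 : ℝ) ≤ Fintype.card V := by exact_mod_cast h2
    set n : ℝ := (Fintype.card V : ℝ) with hndef
    set D : ℝ := (G.maxDegree : ℝ) with hDdef
    set t : ℝ := (treewidth G : ℝ) with htdef
    have hlog2 : 1 / 2 < Real.log 2 := by
      have := Real.log_two_gt_d9
      linarith
    have hl : 1 / 2 < Real.log n := hlog2.trans_le (Real.log_le_log two_pos hn)
    set l := Real.log n with hldef
    refine (reconstructsWithin_of_cover_of_two_le r h2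
      (N := (t + 1) * (D + 1) * n * (l / Real.log 2)) (by positivity)
      fun X hX hXG => ?_).mono ?_
    · obtain ⟨T, hT, hTc⟩ := (E.ofLE hXG).exists_isCover hX
        (card_filter_adj_le_maxDegree hXG) _ Finset.univ rfl
      have hw : (E.ofLE hXG).width = treewidth G := hE
      rw [hw, Finset.card_univ] at hTc
      exact ⟨T, hT, hTc⟩
    · rw [← hndef, ← hDdef, ← hldef]
      have hdiv : l / Real.log 2 ≤ 2 * l := by
        rw [div_le_iff₀ (by linarith)]
        nlinarith
      -- The confirming queries number only $O(\Delta\,\mathrm{tw}\,n\log^2 n)$; the factor $2l\ge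
      -- 1$ supplies the extra logarithm of the stated bound. The term $\Delta^2 n\log^2 n$ absorbs
      -- the initial loop and the edge discoveries.
      have hN : 2 * ((t + 1) * (D + 1) * n * (l / Real.log 2)) * l ≤
          32 * (D * (t * l) * n * l ^ 2) := by
        calc 2 * ((t + 1) * (D + 1) * n * (l / Real.log 2)) * l
            ≤ 2 * ((2 * t) * (2 * D) * n * (2 * l)) * l := by
              gcongr <;> linarith
          _ = 16 * (t * D * n * l ^ 2) * 1 := by ring
          _ ≤ 16 * (t * D * n * l ^ 2) * (2 * l) := by
              gcongr
              linarith
          _ = _ := by ring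
      have hE2 : n + n * D ≤ 32 * (D * D * n * l ^ 2) := by
        have h3 : n * 1 ≤ n * D := by gcongr
        have h4 : n * D * 1 * 1 ≤ n * D * D * (4 * l ^ 2) := by
          gcongr
          nlinarith
        have h5 : 0 ≤ n * D * D * l ^ 2 := by positivity
        nlinarith
      calc n + n * D + 2 * ((t + 1) * (D + 1) * n * (l / Real.log 2)) * l
          ≤ 32 * (D * D * n * l ^ 2) + 32 * (D * (t * l) * n * l ^ 2) := add_le_add hE2 hN
        _ = _ := by ring

theorem exists_polylog_bound (c : ℝ) (k : ℕ) : ∃ (C : ℝ) (m : ℕ), 0 < C ∧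
    ∀ (V : Type u) [Fintype V] (r : GreedyRule V) (G : SimpleGraph V) [DecidableRel G.Adj],
      G.Connected → (G.maxDegree : ℝ) ≤ c * Real.log (Fintype.card V : ℝ) ^ k →
      (treewidth G : ℝ) ≤ c * Real.log (Fintype.card V : ℝ) ^ k →
      (greedy r).ReconstructsWithin G
        (C * ((Fintype.card V : ℝ) * Real.log (Fintype.card V : ℝ) ^ m)) := by
  obtain ⟨C, hC, h⟩ := exists_treewidth_bound.{u}
  -- The factor 3 comes from $1+l\le 3l$ for $l>1/2$, and the added 1 keeps the constant positive
  -- when $c=0$.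
  refine ⟨C * (3 * c ^ 2) + 1, 2 * k + 3, by positivity, fun V _ r G _ hG hD ht => ?_⟩
  have hpos : 0 < Fintype.card V := Fintype.card_pos_iff.2 hG.nonempty
  refine (h V r G hG).mono ?_
  obtain h1 | h2 : Fintype.card V = 1 ∨ 2 ≤ Fintype.card V := by omega
  · simp [h1]
  · have hn : (2 : ℝ) ≤ Fintype.card V := by exact_mod_cast h2
    have hD0 : (0 : ℝ) ≤ G.maxDegree := by positivity
    have ht0 : (0 : ℝ) ≤ treewidth G := by positivity
    set n : ℝ := (Fintype.card V : ℝ)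
    set D : ℝ := (G.maxDegree : ℝ)
    set t : ℝ := (treewidth G : ℝ)
    have hl : 1 / 2 < Real.log n := by
      have h3 := Real.log_two_gt_d9
      have h4 := Real.log_le_log two_pos hn
      linarith
    set l := Real.log n
    set x := c * l ^ k with hx
    have hx0 : 0 ≤ x := hD0.trans hD
    calc C * (D * (D + t * l) * n * l ^ 2) ≤ C * (x * (x + x * l) * n * l ^ 2) := by gcongr
      _ = C * (x ^ 2 * (1 + l) * n * l ^ 2) := by ring
      _ ≤ C * (x ^ 2 * (3 * l) * n * l ^ 2) := by
          gcongr
          linarith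
      _ = C * (3 * c ^ 2) * (n * l ^ (2 * k + 3)) := by rw [hx]; ring
      _ ≤ (C * (3 * c ^ 2) + 1) * (n * l ^ (2 * k + 3)) := by
          gcongr
          linarith

end SPReconstruction

theorem theorem3 :
    -- the greedy algorithm exists on every nonempty finite vertex set
    (∀ (V : Type u) [Fintype V] [Nonempty V], Nonempty (SPReconstruction.GreedyRule V)) ∧
    -- the general query bound
    (∃ C : ℝ, 0 < C ∧
      ∀ (V : Type u) [Fintype V] (r : SPReconstruction.GreedyRule V)
        (G : SimpleGraph V) [DecidableRel G.Adj], G.Connected → 3 ≤ Fintype.card V →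
        (SPReconstruction.greedy r).ReconstructsWithin G
          ((Fintype.card V : ℝ) ^ (1 + C * Real.sqrt
            ((Real.log (Real.log (Fintype.card V : ℝ)) + Real.log (G.maxDegree : ℝ)) /
              Real.log (Fintype.card V : ℝ))))) ∧
    -- the bound is `n ^ (1 + o(1))` when the maximum degree is `n ^ o(1)`
    (∀ ε : ℕ → ℝ, Filter.Tendsto ε Filter.atTop (nhds 0) →
      ∃ η : ℕ → ℝ, Filter.Tendsto η Filter.atTop (nhds 0) ∧
        ∀ (V : Type u) [Fintype V] (r : SPReconstruction.GreedyRule V)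
          (G : SimpleGraph V) [DecidableRel G.Adj], G.Connected →
          (G.maxDegree : ℝ) ≤ (Fintype.card V : ℝ) ^ ε (Fintype.card V) →
          (SPReconstruction.greedy r).ReconstructsWithin G
            ((Fintype.card V : ℝ) ^ (1 + η (Fintype.card V)))) ∧
    -- the query bound in terms of the treewidth
    (∃ C : ℝ, 0 < C ∧
      ∀ (V : Type u) [Fintype V] (r : SPReconstruction.GreedyRule V)
        (G : SimpleGraph V) [DecidableRel G.Adj], G.Connected →
        (SPReconstruction.greedy r).ReconstructsWithin G
          (C * ((G.maxDegree : ℝ) *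
            ((G.maxDegree : ℝ) +
              (SPReconstruction.treewidth G : ℝ) * Real.log (Fintype.card V : ℝ)) *
            (Fintype.card V : ℝ) * Real.log (Fintype.card V : ℝ) ^ 2))) ∧
    -- the bound is `n * polylog n` when maximum degree and treewidth are polylogarithmic
    (∀ (c : ℝ) (k : ℕ), ∃ (C : ℝ) (m : ℕ), 0 < C ∧
      ∀ (V : Type u) [Fintype V] (r : SPReconstruction.GreedyRule V)
        (G : SimpleGraph V) [DecidableRel G.Adj], G.Connected →
        (G.maxDegree : ℝ) ≤ c * Real.log (Fintype.card V : ℝ) ^ k →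
        (SPReconstruction.treewidth G : ℝ) ≤ c * Real.log (Fintype.card V : ℝ) ^ k →
        (SPReconstruction.greedy r).ReconstructsWithin G
          (C * ((Fintype.card V : ℝ) * Real.log (Fintype.card V : ℝ) ^ m))) := by
  exact ⟨fun V _ _ => SPReconstruction.nonempty_greedyRule V,
    SPReconstruction.exists_general_bound, SPReconstruction.exists_exponent_tendsto,
    SPReconstruction.exists_treewidth_bound, SPReconstruction.exists_polylog_bound⟩
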